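/- Let $K$ be a nonarchimedean local field with canonical absolute value $|\cdot|$, valuation ring $R=\{x:|x|\le 1\}$, maximal ideal $P=\{x:|x|<1\}$ and residue field $R/P$ of cardinality $q$, so that $|\pi|=1/q$ whenever $P=\pi R$. Let $\mu$ be the additive Haar measure on $K$ with $\mu(R)=1$. On the projective line $\mathbb{P}^1(K)$, with its quotient topology from $K^2\setminus\{(0,0)\}$, let $$\delta([x_0:x_1],[y_0:y_1])=\frac{|x_0y_1-x_1y_0|}{\max\{|x_0|,|x_1|\}\cdot\max\{|y_0|,|y_1|\}}$$ be the spherical metric, and let $\nu$ be the unique $PGL_2(R)$-invariant Borel probability measure. Let $N\ge 2$, $[N]=\{1,\dots,N\}$, and let $\boldsymbol{s}=(s_{ij})_{1\le i<j\le N}$ be a tuple of complex numbers. Put $$\mathcal{Z}_N(\mathbb{P}^1(K),\boldsymbol{s})=\int_{\mathbb{P}^1(K)^N}\prod_{1\le i<j\le N}\delta(x_i,x_j)^{s_{ij}}\,d\nu^N,$$ and for $I\subset[N]$ put $$\mathcal{Z}_I(P,\boldsymbol{s})=\int_{P^I}\prod_{\substack{i<j\\ i,j\in I}}|x_i-x_j|^{s_{ij}}\,d\mu^I\quad(I\ne\varnothing),\qquad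 \mathcal{Z}_\varnothing(P,\boldsymbol{s})=1.$$ Let $\Omega_N$ be the set of all $\boldsymbol{s}$ such that $$\operatorname{Re}\Big(\#\lambda-1+\sum_{\substack{i<j\\ i,j\in\lambda}}s_{ij}\Big)>0\qquad\text{for every }\lambda\subset[N]\text{ with }\#\lambda>1.$$ Theorem. The integral $\mathcal{Z}_N(\mathbb{P}^1(K),\boldsymbol{s})$ converges absolutely if and only if $\boldsymbol{s}\in\Omega_N$, and in this case $$\mathcal{Z}_N(\mathbb{P}^1(K),\boldsymbol{s})=\Big(\frac{q}{q+1}\Big)^N\sum_{(I_0,\dots,I_q)}\ \prod_{k=0}^q\mathcal{Z}_{I_k}(P,\boldsymbol{s}),$$ where the sum is over all $(q+1)$-tuples $(I_0,\dots,I_q)$ of pairwise disjoint, possibly empty subsets of $[N]$ with union $[N]$. -/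

import Mathlib

open MeasureTheory Metric
open scoped LinearAlgebra.Projectivization ENNReal

noncomputable section

namespace LogCoulomb

/-! ### The field and its absolute value

A nonarchimedean local field (a `p`-field) is modelled as a nontrivially normed field `K` whose norm
is ultrametric and whose topology is locally compact. Its norm is the *canonical* absolute value
when uniformizers have norm `1 / q`, where `q` is the cardinality of the residue field. -/

section Field

variable (K : Type*) [NontriviallyNormedField K] [IsUltrametricDist K]

/-- The valuation ring `R = {x : ‖x‖ ≤ 1}`. -/
abbrev intRing : Subring K := @Valued.integer K _ NNReal _ NormedField.toValued

/-- `q`, the cardinality of the residue field `R / P`. -/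
def residueCard : ℕ := Nat.card (IsLocalRing.ResidueField (intRing K))

/-- The norm of `K` is its canonical absolute value: every uniformizer has absolute value `1 / q`. -/
def IsCanonicalNorm : Prop :=
  ∀ ϖ : intRing K, Irreducible ϖ → ‖(ϖ : K)‖ = (residueCard K : ℝ)⁻¹

theorem mem_intRing_iff (x : K) : x ∈ intRing K ↔ ‖x‖ ≤ 1 :=
  letI := NormedField.toValued (K := K)
  Valued.integer.mem_iff

end Field

/-! ### Haar measure on the field -/

section Haar

variable (K : Type*) [NontriviallyNormedField K] [LocallyCompactSpace K]

/-- The closed unit ball `R`, as a compact set with nonempty interior. -/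
def unitBall : TopologicalSpace.PositiveCompacts K where
  carrier := closedBall 0 1
  isCompact' :=
    haveI : ProperSpace K := ProperSpace.of_locallyCompactSpace K
    isCompact_closedBall 0 1
  interior_nonempty' := ⟨0, ball_subset_interior_closedBall (mem_ball_self one_pos)⟩

/-- `μ`, the additive Haar measure on `K` with `μ R = 1`. -/
def haar [MeasurableSpace K] [BorelSpace K] : Measure K := Measure.addHaarMeasure (unitBall K)

instance [MeasurableSpace K] [BorelSpace K] : (haar K).IsAddHaarMeasure := by
  unfold haar; infer_instance

instance [MeasurableSpace K] [BorelSpace K] : SigmaFinite (haar K) := by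
  have : ProperSpace K := ProperSpace.of_locallyCompactSpace K
  infer_instance

theorem haar_closedBall [MeasurableSpace K] [BorelSpace K] : haar K (closedBall 0 1) = 1 :=
  Measure.addHaarMeasure_self (K₀ := unitBall K)

end Haar

/-! ### The projective line, with its topology, metric and measure -/

section ProjectiveLine

variable (K : Type*) [NontriviallyNormedField K]

/-- The projective line `ℙ¹(K)`: nonzero vectors `(x 0, x 1)` up to scaling. -/
abbrev ProjLine : Type _ := ℙ K (Fin 2 → K)

/-- The quotient topology, induced by `(x 0, x 1) ↦ [x 0 : x 1]`. -/
instance : TopologicalSpace (ProjLine K) :=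
  TopologicalSpace.coinduced (Projectivization.mk' K) inferInstance

instance : MeasurableSpace (ProjLine K) := borel _

instance : BorelSpace (ProjLine K) := ⟨rfl⟩

variable {K}

/-- The spherical metric, computed on representatives. -/
def sphericalDist (p r : ProjLine K) : ℝ :=
  ‖p.rep 0 * r.rep 1 - p.rep 1 * r.rep 0‖ /
    (max ‖p.rep 0‖ ‖p.rep 1‖ * max ‖r.rep 0‖ ‖r.rep 1‖)

/-- The spherical metric does not depend on the choice of representatives. -/
theorem sphericalDist_mk (x y : Fin 2 → K) (hx : x ≠ 0) (hy : y ≠ 0) :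
    sphericalDist (Projectivization.mk K x hx) (Projectivization.mk K y hy) =
      ‖x 0 * y 1 - x 1 * y 0‖ / (max ‖x 0‖ ‖x 1‖ * max ‖y 0‖ ‖y 1‖) := by
  obtain ⟨a, ha⟩ := Projectivization.exists_smul_eq_mk_rep K x hx
  obtain ⟨b, hb⟩ := Projectivization.exists_smul_eq_mk_rep K y hy
  have ha0 : ‖(a : K)‖ ≠ 0 := by simp
  have hb0 : ‖(b : K)‖ ≠ 0 := by simp
  simp only [sphericalDist, ← ha, ← hb, Pi.smul_apply, Units.smul_def, smul_eq_mul, norm_mul]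
  rw [← mul_max_of_nonneg _ _ (norm_nonneg _), ← mul_max_of_nonneg _ _ (norm_nonneg _),
    show (a : K) * x 0 * (b * y 1) - a * x 1 * (b * y 0) = a * b * (x 0 * y 1 - x 1 * y 0) by ring,
    norm_mul, norm_mul,
    show ‖(a : K)‖ * max ‖x 0‖ ‖x 1‖ * (‖(b : K)‖ * max ‖y 0‖ ‖y 1‖) =
      (‖(a : K)‖ * ‖(b : K)‖) * (max ‖x 0‖ ‖x 1‖ * max ‖y 0‖ ‖y 1‖) by ring,
    mul_div_mul_left _ _ (mul_ne_zero ha0 hb0)]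

variable (K) in
/-- `GL₂(R)`: matrices with entries in `R` and determinant in `Rˣ`. -/
def integralGL : Set (GL (Fin 2) K) :=
  {A | (∀ i j, ‖(A : Matrix (Fin 2) (Fin 2) K) i j‖ ≤ 1) ∧
    ‖(A : Matrix (Fin 2) (Fin 2) K).det‖ = 1}

/-- The projective transformation `[x 0 : x 1] ↦ [a x 0 + b x 1 : c x 0 + d x 1]` given by an
invertible matrix; scalar matrices act trivially, so `GL₂(R)` acts through `PGL₂(R)`. -/
def moebius (A : GL (Fin 2) K) (p : ProjLine K) : ProjLine K :=
  Matrix.GeneralLinearGroup.toLin A • p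

/-- The vectors `(x 0, x 1)` with `max ‖x 0‖ ‖x 1‖ = 1`. -/
def primitiveVectors (K : Type*) [NontriviallyNormedField K] : Set (Fin 2 → K) := sphere 0 1

/-- The Haar measure on `K²`. -/
abbrev planeHaar (K : Type*) [NontriviallyNormedField K] [LocallyCompactSpace K]
    [MeasurableSpace K] [BorelSpace K] : Measure (Fin 2 → K) :=
  Measure.pi fun _ : Fin 2 => haar K

/-- `ν`, the `PGL₂(R)`-invariant Borel probability measure on the projective line, constructed as
the image of the normalized Haar measure on the primitive vectors of `K²`. It is characterized by
its invariance: see `eq_projMeasure_iff`. -/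
def projMeasure (K : Type*) [NontriviallyNormedField K] [LocallyCompactSpace K]
    [MeasurableSpace K] [BorelSpace K] : Measure (ProjLine K) :=
  ((ProbabilityTheory.cond (planeHaar K) (primitiveVectors K)).comap
    (Subtype.val : {v : Fin 2 → K // v ≠ 0} → Fin 2 → K)).map (Projectivization.mk' K)

end ProjectiveLine

section Invariance

variable {K : Type*} [NontriviallyNormedField K]

theorem inv_mem_integralGL {A : GL (Fin 2) K} (hA : A ∈ integralGL K) : A⁻¹ ∈ integralGL K := by
  have h : ((A⁻¹ : GL (Fin 2) K) : Matrix (Fin 2) (Fin 2) K).det =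
      ((A : Matrix (Fin 2) (Fin 2) K).det)⁻¹ := by
    rw [Matrix.coe_units_inv, Matrix.det_nonsing_inv, Ring.inverse_eq_inv']
  refine ⟨fun i j => ?_, by rw [h, norm_inv, hA.2, inv_one]⟩
  rw [Matrix.coe_units_inv, Matrix.inv_def, Matrix.smul_apply, smul_eq_mul, norm_mul,
    Ring.inverse_eq_inv', norm_inv, hA.2, inv_one, one_mul, Matrix.adjugate_fin_two]
  fin_cases i <;> fin_cases j <;> simpa using hA.1 _ _

theorem norm_toLin_le [IsUltrametricDist K] {A : GL (Fin 2) K} (hA : A ∈ integralGL K)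
    (v : Fin 2 → K) : ‖(A : Matrix (Fin 2) (Fin 2) K).mulVec v‖ ≤ ‖v‖ := by
  refine (pi_norm_le_iff_of_nonneg (norm_nonneg _)).2 fun i => ?_
  simp only [Matrix.mulVec, dotProduct, Fin.sum_univ_two]
  refine (IsUltrametricDist.norm_add_le_max _ _).trans (max_le ?_ ?_) <;>
  · rw [norm_mul]
    exact (mul_le_of_le_one_left (norm_nonneg _) (hA.1 _ _)).trans (norm_le_pi_norm v _)

theorem norm_toLin [IsUltrametricDist K] {A : GL (Fin 2) K} (hA : A ∈ integralGL K)
    (v : Fin 2 → K) : ‖(A : Matrix (Fin 2) (Fin 2) K).mulVec v‖ = ‖v‖ := by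
  refine le_antisymm (norm_toLin_le hA v) ?_
  have := norm_toLin_le (inv_mem_integralGL hA) ((A : Matrix (Fin 2) (Fin 2) K).mulVec v)
  rwa [Matrix.mulVec_mulVec, ← Units.val_mul, inv_mul_cancel, Units.val_one, Matrix.one_mulVec]
    at this

/-- An invertible matrix as a homeomorphic linear automorphism of the plane. -/
def toCLE (A : GL (Fin 2) K) : (Fin 2 → K) ≃L[K] (Fin 2 → K) where
  toLinearEquiv := LinearMap.GeneralLinearGroup.toLinearEquiv (Matrix.GeneralLinearGroup.toLin A)
  continuous_toFun := by
    show Continuous fun v => (A : Matrix (Fin 2) (Fin 2) K).mulVec v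
    fun_prop
  continuous_invFun := by
    show Continuous fun v => ((A⁻¹ : GL (Fin 2) K) : Matrix (Fin 2) (Fin 2) K).mulVec v
    fun_prop

theorem toCLE_apply (A : GL (Fin 2) K) (v : Fin 2 → K) :
    toCLE A v = (A : Matrix (Fin 2) (Fin 2) K).mulVec v := rfl

theorem isOpenQuotientMap_mk : IsOpenQuotientMap (Projectivization.mk' K (V := Fin 2 → K)) := by
  refine ⟨Quot.mk_surjective, continuous_coinduced_rng, fun U hU => ?_⟩
  refine isOpen_coinduced.2 ?_
  have : Projectivization.mk' K ⁻¹' (Projectivization.mk' K '' U) =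
      ⋃ a : Kˣ, {v : {v : Fin 2 → K // v ≠ 0} |
        (⟨a • (v : Fin 2 → K), (smul_ne_zero_iff_ne a).2 v.2⟩ : {v : Fin 2 → K // v ≠ 0}) ∈ U} := by
    ext v
    simp only [Set.mem_preimage, Set.mem_image, Set.mem_iUnion, Set.mem_ofPred_eq]
    constructor
    · rintro ⟨w, hw, h⟩
      obtain ⟨a, ha⟩ := (Projectivization.mk_eq_mk_iff K _ _ w.2 v.2).1 h
      exact ⟨a, by convert hw⟩
    · rintro ⟨a, ha⟩
      exact ⟨_, ha, (Projectivization.mk_eq_mk_iff K _ _ _ v.2).2 ⟨a, rfl⟩⟩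
  rw [this]
  refine isOpen_iUnion fun a => hU.preimage ?_
  exact Continuous.subtype_mk (continuous_subtype_val.const_smul a) _

theorem moebius_mk (A : GL (Fin 2) K) (v : {v : Fin 2 → K // v ≠ 0}) :
    moebius A (Projectivization.mk' K v) = Projectivization.mk' K
      ⟨toCLE A v, fun h => v.2 ((toCLE A).map_eq_zero_iff.1 h)⟩ := rfl

theorem continuous_moebius (A : GL (Fin 2) K) : Continuous (moebius A) := by
  rw [← isOpenQuotientMap_mk.continuous_comp_iff]
  show Continuous fun v => moebius A (Projectivization.mk' K v)
  simp only [moebius_mk]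
  exact isOpenQuotientMap_mk.continuous.comp
    (((toCLE A).continuous.comp continuous_subtype_val).subtype_mk _)

variable [LocallyCompactSpace K] [MeasurableSpace K] [BorelSpace K]

theorem planeHaar_closedBall : planeHaar K (closedBall 0 1) = 1 := by
  rw [closedBall_pi _ zero_le_one, Measure.pi_pi]
  simp [haar_closedBall]

theorem planeHaar_map [IsUltrametricDist K] {A : GL (Fin 2) K} (hA : A ∈ integralGL K) :
    MeasurePreserving (toCLE A) (planeHaar K) (planeHaar K) := by
  have : ProperSpace K := ProperSpace.of_locallyCompactSpace K
  refine ⟨(toCLE A).continuous.measurable, ?_⟩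
  have : ((planeHaar K).map (toCLE A)).IsAddHaarMeasure :=
    (toCLE A).isAddHaarMeasure_map (planeHaar K)
  have h := Measure.isAddLeftInvariant_eq_smul ((planeHaar K).map (toCLE A)) (planeHaar K)
  have h1 : (planeHaar K).map (toCLE A) (closedBall 0 1) = 1 := by
    rw [Measure.map_apply (toCLE A).continuous.measurable isClosed_closedBall.measurableSet]
    convert planeHaar_closedBall (K := K) using 2
    ext v
    rw [Set.mem_preimage, mem_closedBall_zero_iff, mem_closedBall_zero_iff, toCLE_apply,
      norm_toLin hA]
  rw [h, Measure.smul_apply, planeHaar_closedBall] at h1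
  rw [h]
  have : Measure.addHaarScalarFactor ((planeHaar K).map (toCLE A)) (planeHaar K) = 1 := by
    simpa [ENNReal.smul_def] using h1
  rw [this, one_smul]


theorem planeHaar_primitive_ne_top : planeHaar K (primitiveVectors K) ≠ ⊤ := by
  refine ne_top_of_le_ne_top ENNReal.one_ne_top ?_
  rw [← planeHaar_closedBall (K := K)]
  exact measure_mono sphere_subset_closedBall

theorem planeHaar_primitive_ne_zero [IsUltrametricDist K] :
    planeHaar K (primitiveVectors K) ≠ 0 := by
  refine ((IsUltrametricDist.isOpen_sphere (0 : Fin 2 → K) one_ne_zero).measure_pos _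
    ⟨fun _ => 1, ?_⟩).ne'
  simp [pi_norm_const]

theorem projMeasure_apply {M : Set (ProjLine K)} (hM : MeasurableSet M) :
    projMeasure K M = (planeHaar K (primitiveVectors K))⁻¹ * planeHaar K
      (primitiveVectors K ∩ Subtype.val '' (Projectivization.mk' K ⁻¹' M)) := by
  have : ProperSpace K := ProperSpace.of_locallyCompactSpace K
  have emb : MeasurableEmbedding (Subtype.val : {v : Fin 2 → K // v ≠ 0} → Fin 2 → K) :=
    MeasurableEmbedding.subtype_coe (measurableSet_singleton 0).compl
  have hm := isOpenQuotientMap_mk.continuous.measurable (f := Projectivization.mk' K (V := Fin 2 → K))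
  rw [projMeasure, Measure.map_apply hm hM,
    emb.comap_apply,
    ProbabilityTheory.cond_apply (show MeasurableSet (primitiveVectors K) from
      isClosed_sphere.measurableSet)]

instance [IsUltrametricDist K] : IsProbabilityMeasure (projMeasure K) := by
  refine ⟨?_⟩
  have h : primitiveVectors K ∩ Subtype.val ''
      (Projectivization.mk' K (V := Fin 2 → K) ⁻¹' Set.univ) = primitiveVectors K := by
    refine Set.inter_eq_left.2 fun v hv => ⟨⟨v, ?_⟩, trivial, rfl⟩
    rintro rfl
    simp [primitiveVectors] at hv
  rw [projMeasure_apply MeasurableSet.univ, h,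
    ENNReal.inv_mul_cancel planeHaar_primitive_ne_zero planeHaar_primitive_ne_top]

theorem projMeasure_map [IsUltrametricDist K] {A : GL (Fin 2) K} (hA : A ∈ integralGL K) :
    (projMeasure K).map (moebius A) = projMeasure K := by
  have : ProperSpace K := ProperSpace.of_locallyCompactSpace K
  ext M hM
  have hm := isOpenQuotientMap_mk.continuous.measurable (f := Projectivization.mk' K (V := Fin 2 → K))
  have h0 : MeasurableSet {v : Fin 2 → K | v ≠ 0} := (measurableSet_singleton 0).compl
  have hA' := (continuous_moebius A).measurable
  rw [Measure.map_apply hA' hM, projMeasure_apply hM, projMeasure_apply (hA' hM)]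
  congr 1
  have hs : MeasurableSet (primitiveVectors K ∩ Subtype.val ''
      (Projectivization.mk' K (V := Fin 2 → K) ⁻¹' M)) :=
    isClosed_sphere.measurableSet.inter (h0.subtype_image (hm hM))
  rw [← (planeHaar_map hA).measure_preimage hs.nullMeasurableSet]
  congr 1
  ext v
  simp only [primitiveVectors, Set.mem_inter_iff, mem_sphere_zero_iff_norm, Set.mem_preimage,
    Set.mem_image, toCLE_apply, norm_toLin hA]
  refine and_congr_right fun _ => ⟨?_, ?_⟩
  · rintro ⟨w, hw, rfl⟩
    exact ⟨_, hw, rfl⟩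
  · rintro ⟨w, hw, h⟩
    have hv : v ≠ 0 := by
      rintro rfl
      exact w.2 (by rw [h, Matrix.mulVec_zero])
    refine ⟨⟨v, hv⟩, ?_, rfl⟩
    rw [moebius_mk]
    convert hw
    exact h.symm

end Invariance

section Uniqueness

variable {K : Type*} [NontriviallyNormedField K]

variable (K) in
/-- `GL₂(R)` as a subset of the space of matrices. -/
def intMatrices : Set (Fin 2 → Fin 2 → K) :=
  {A | (∀ i j, ‖A i j‖ ≤ 1) ∧ ‖(Matrix.of A).det‖ = 1}

/-- A matrix in `GL₂(R)` as an invertible matrix. -/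
def toGL (A : intMatrices K) : GL (Fin 2) K :=
  Matrix.GeneralLinearGroup.mkOfDetNeZero (Matrix.of A.1) (norm_ne_zero_iff.1 (by simp [A.2.2]))

theorem toGL_mem (A : intMatrices K) : toGL A ∈ integralGL K := A.2

theorem continuous_action :
    Continuous fun x : intMatrices K × ProjLine K => moebius (toGL x.1) x.2 := by
  rw [← (IsOpenQuotientMap.id.prodMap isOpenQuotientMap_mk).continuous_comp_iff]
  have : Continuous fun x : intMatrices K × {v : Fin 2 → K // v ≠ 0} =>
      (Matrix.of x.1.1).mulVec x.2.1 := by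
    have h : Continuous fun x : intMatrices K × {v : Fin 2 → K // v ≠ 0} => Matrix.of x.1.1 :=
      (continuous_subtype_val (p := (· ∈ intMatrices K))).comp continuous_fst
    exact h.matrix_mulVec (continuous_subtype_val.comp continuous_snd)
  exact isOpenQuotientMap_mk.continuous.comp (this.subtype_mk _)

theorem moebius_mul (A B : GL (Fin 2) K) (p : ProjLine K) :
    moebius (A * B) p = moebius A (moebius B p) := by
  simp [moebius, mul_smul]

variable (K) in
/-- The point `[1 : 0]`. -/
def northPole : ProjLine K := Projectivization.mk K ![1, 0] (by simp)

theorem moebius_northPole (A : GL (Fin 2) K) (v : Fin 2 → K) (hv : v ≠ 0) (c : K)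
    (h0 : c * v 0 = (A : Matrix (Fin 2) (Fin 2) K) 0 0)
    (h1 : c * v 1 = (A : Matrix (Fin 2) (Fin 2) K) 1 0) :
    moebius A (northPole K) = Projectivization.mk K v hv := by
  refine (Projectivization.mk_eq_mk_iff' K _ _ _ hv).2 ⟨c, ?_⟩
  show c • v = (A : Matrix (Fin 2) (Fin 2) K).mulVec ![1, 0]
  ext i
  fin_cases i <;> simp [Matrix.mulVec, dotProduct, h0, h1]

theorem exists_moebius_northPole (p : ProjLine K) :
    ∃ A ∈ integralGL K, moebius A (northPole K) = p := by
  induction p using Projectivization.ind with | h v hv =>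
  by_cases h : ‖v 0‖ ≤ ‖v 1‖
  · have h1 : v 1 ≠ 0 := by
      intro h1
      rw [h1, norm_zero, norm_le_zero_iff] at h
      exact hv (funext fun i => by fin_cases i <;> simp [h, h1])
    refine ⟨Matrix.GeneralLinearGroup.mkOfDetNeZero !![v 0 / v 1, 1; 1, 0] (by simp), ⟨?_, ?_⟩,
      moebius_northPole _ v hv (v 1)⁻¹ ?_ ?_⟩
    · intro i j
      fin_cases i <;> fin_cases j <;>
        simp [Matrix.GeneralLinearGroup.mkOfDetNeZero, div_le_one (norm_pos_iff.2 h1), h]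
    · simp [Matrix.GeneralLinearGroup.mkOfDetNeZero]
    · simp [Matrix.GeneralLinearGroup.mkOfDetNeZero, div_eq_inv_mul]
    · simp [Matrix.GeneralLinearGroup.mkOfDetNeZero, h1]
  · have h0 : v 0 ≠ 0 := fun h0 => h (by simp [h0])
    refine ⟨Matrix.GeneralLinearGroup.mkOfDetNeZero !![1, 0; v 1 / v 0, 1] (by simp), ⟨?_, ?_⟩,
      moebius_northPole _ v hv (v 0)⁻¹ ?_ ?_⟩
    · intro i j
      fin_cases i <;> fin_cases j <;>
        simp [Matrix.GeneralLinearGroup.mkOfDetNeZero, div_le_one (norm_pos_iff.2 h0),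
          (not_le.1 h).le]
    · simp [Matrix.GeneralLinearGroup.mkOfDetNeZero]
    · simp [Matrix.GeneralLinearGroup.mkOfDetNeZero, h0]
    · simp [Matrix.GeneralLinearGroup.mkOfDetNeZero, div_eq_inv_mul]

theorem transpose_mem {A : GL (Fin 2) K} (hA : A ∈ integralGL K) :
    Matrix.GeneralLinearGroup.mkOfDetNeZero (A : Matrix (Fin 2) (Fin 2) K).transpose
      (by rw [Matrix.det_transpose]; exact norm_ne_zero_iff.1 (by simp [hA.2])) ∈ integralGL K :=
  ⟨fun i j => hA.1 j i, (congrArg norm (Matrix.det_transpose _)).trans hA.2⟩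

/-- Right multiplication of a matrix by `B`. -/
def mulRight (B : GL (Fin 2) K) (A : Fin 2 → Fin 2 → K) : Fin 2 → Fin 2 → K :=
  Matrix.of A * (B : Matrix (Fin 2) (Fin 2) K)

theorem mulRight_mem [IsUltrametricDist K] {B : GL (Fin 2) K} (hB : B ∈ integralGL K)
    (A : Fin 2 → Fin 2 → K) : mulRight B A ∈ intMatrices K ↔ A ∈ intMatrices K := by
  have key : ∀ {B : GL (Fin 2) K}, B ∈ integralGL K → ∀ A : Fin 2 → Fin 2 → K,
      A ∈ intMatrices K → mulRight B A ∈ intMatrices K := by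
    intro B hB A hA
    refine ⟨fun i j => ?_, ?_⟩
    · simp only [mulRight, Matrix.mul_apply, Fin.sum_univ_two]
      refine (IsUltrametricDist.norm_add_le_max _ _).trans (max_le ?_ ?_) <;>
      · rw [norm_mul]
        exact mul_le_one₀ (hA.1 _ _) (norm_nonneg _) (hB.1 _ _)
    · show ‖(Matrix.of A * (B : Matrix (Fin 2) (Fin 2) K)).det‖ = 1
      rw [Matrix.det_mul, norm_mul, hA.2, hB.2, one_mul]
  refine ⟨fun h => ?_, key hB A⟩
  have := key (inv_mem_integralGL hB) _ h
  have e : mulRight B⁻¹ (mulRight B A) = A := by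
    show Matrix.of A * (B : Matrix (Fin 2) (Fin 2) K) *
      ((B⁻¹ : GL (Fin 2) K) : Matrix (Fin 2) (Fin 2) K) = A
    rw [mul_assoc, ← Units.val_mul, mul_inv_cancel, Units.val_one, mul_one]
    rfl
  rwa [e] at this

theorem toGL_mulRight {B : GL (Fin 2) K} (A : intMatrices K) (h : mulRight B A.1 ∈ intMatrices K) :
    toGL ⟨mulRight B A.1, h⟩ = toGL A * B :=
  Units.ext rfl

theorem isOpen_intMatrices [IsUltrametricDist K] : IsOpen (intMatrices K) := by
  have h1 : IsOpen {A : Fin 2 → Fin 2 → K | ∀ i j, ‖A i j‖ ≤ 1} := by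
    simp only [Set.ofPred_forall]
    refine isOpen_iInter_of_finite fun i => isOpen_iInter_of_finite fun j => ?_
    have : Continuous fun A : Fin 2 → Fin 2 → K => A i j := by fun_prop
    convert (IsUltrametricDist.isOpen_closedBall (0 : K) one_ne_zero).preimage this
    ext A
    simp
  have h2 : IsOpen {A : Fin 2 → Fin 2 → K | ‖(Matrix.of A).det‖ = 1} := by
    have : Continuous fun A : Fin 2 → Fin 2 → K => (Matrix.of A).det :=
      Continuous.matrix_det continuous_id
    convert (IsUltrametricDist.isOpen_sphere (0 : K) one_ne_zero).preimage this
    ext A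
    simp
  exact h1.inter h2

variable [LocallyCompactSpace K] [MeasurableSpace K] [BorelSpace K]

theorem measurePreserving_mulRight [IsUltrametricDist K] {B : GL (Fin 2) K}
    (hB : B ∈ integralGL K) :
    MeasurePreserving (mulRight B) (Measure.pi fun _ : Fin 2 => planeHaar K)
      (Measure.pi fun _ : Fin 2 => planeHaar K) := by
  have : ProperSpace K := ProperSpace.of_locallyCompactSpace K
  have := measurePreserving_pi (fun _ : Fin 2 => planeHaar K) (fun _ : Fin 2 => planeHaar K)
    (fun _ => planeHaar_map (transpose_mem hB))
  convert this using 1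
  ext A i j
  simp [mulRight, toCLE_apply, Matrix.GeneralLinearGroup.mkOfDetNeZero, Matrix.mul_apply,
    Matrix.mulVec, dotProduct, mul_comm]

theorem measure_intMatrices_ne_zero [IsUltrametricDist K] :
    (Measure.pi fun _ : Fin 2 => planeHaar K) (intMatrices K) ≠ 0 := by
  refine (isOpen_intMatrices.measure_pos _ ⟨(1 : Matrix (Fin 2) (Fin 2) K), ?_, ?_⟩).ne'
  · intro i j
    fin_cases i <;> fin_cases j <;> simp
  · show ‖(1 : Matrix (Fin 2) (Fin 2) K).det‖ = 1
    simp

theorem measure_intMatrices_ne_top :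
    (Measure.pi fun _ : Fin 2 => planeHaar K) (intMatrices K) ≠ ⊤ := by
  refine ne_top_of_le_ne_top ENNReal.one_ne_top ?_
  calc _ ≤ (Measure.pi fun _ : Fin 2 => planeHaar K) (closedBall 0 1) := by
        refine measure_mono fun A hA => ?_
        rw [mem_closedBall_zero_iff, pi_norm_le_iff_of_nonneg zero_le_one]
        intro i
        rw [pi_norm_le_iff_of_nonneg zero_le_one]
        exact hA.1 i
    _ = 1 := by
        rw [closedBall_pi _ zero_le_one, Measure.pi_pi]
        simp [planeHaar_closedBall]

/-- A `PGL₂(R)`-invariant Borel probability measure on the projective line is determined: the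
measure of a set is the proportion of `GL₂(R)` that sends a fixed point into the set. -/
theorem invariant_apply [IsUltrametricDist K] (ν : Measure (ProjLine K)) [IsProbabilityMeasure ν]
    (hν : ∀ A ∈ integralGL K, ν.map (moebius A) = ν) {M : Set (ProjLine K)}
    (hM : MeasurableSet M) :
    ν M * (Measure.pi fun _ : Fin 2 => planeHaar K) (intMatrices K) =
      (Measure.pi fun _ : Fin 2 => planeHaar K)
        (Subtype.val '' {A : intMatrices K | moebius (toGL A) (northPole K) ∈ M}) := by
  have : ProperSpace K := ProperSpace.of_locallyCompactSpace K
  have : SecondCountableTopology (ProjLine K) :=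
    isOpenQuotientMap_mk.isQuotientMap.secondCountableTopology isOpenQuotientMap_mk.isOpenMap
  have hS : MeasurableSet (intMatrices K) := isOpen_intMatrices.measurableSet
  set m := Measure.pi fun _ : Fin 2 => planeHaar K with hm
  have emb : MeasurableEmbedding (Subtype.val : intMatrices K → Fin 2 → Fin 2 → K) :=
    MeasurableEmbedding.subtype_coe hS
  set mS : Measure (intMatrices K) := m.comap Subtype.val with hmS
  have hmS_univ : mS Set.univ = m (intMatrices K) := by
    rw [hmS, emb.comap_apply, Set.image_univ, Subtype.range_coe]
  have : IsFiniteMeasure mS := ⟨by rw [hmS_univ]; exact measure_intMatrices_ne_top.lt_top⟩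
  have hT : MeasurableSet {x : intMatrices K × ProjLine K | moebius (toGL x.1) x.2 ∈ M} :=
    continuous_action.measurable hM
  have e1 := Measure.prod_apply (μ := mS) (ν := ν) hT
  have e2 := Measure.prod_apply_symm (μ := mS) (ν := ν) hT
  have f1 : ∀ A : intMatrices K, ν (Prod.mk A ⁻¹'
      {x : intMatrices K × ProjLine K | moebius (toGL x.1) x.2 ∈ M}) = ν M := by
    intro A
    conv_rhs => rw [← hν _ (toGL_mem A), Measure.map_apply (continuous_moebius _).measurable hM]
    rfl
  have f2 : ∀ p : ProjLine K, mS ((fun A => (A, p)) ⁻¹'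
      {x : intMatrices K × ProjLine K | moebius (toGL x.1) x.2 ∈ M}) =
      m (Subtype.val '' {A : intMatrices K | moebius (toGL A) (northPole K) ∈ M}) := by
    intro p
    obtain ⟨B, hB, rfl⟩ := exists_moebius_northPole p
    have hs : MeasurableSet {A : intMatrices K | moebius (toGL A) (northPole K) ∈ M} :=
      (measurable_id.prodMk measurable_const) hT
    rw [hmS, emb.comap_apply, ← (measurePreserving_mulRight hB).measure_preimage
      (emb.measurableSet_image.2 hs).nullMeasurableSet]
    congr 1
    ext A
    constructor
    · rintro ⟨A, hA, rfl⟩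
      refine ⟨⟨_, (mulRight_mem hB _).2 A.2⟩, ?_, rfl⟩
      show moebius (toGL ⟨_, _⟩) _ ∈ M
      rw [toGL_mulRight, moebius_mul]
      exact hA
    · rintro ⟨A', hA', h⟩
      have hA : A ∈ intMatrices K := (mulRight_mem hB _).1 (h ▸ A'.2)
      refine ⟨⟨A, hA⟩, ?_, rfl⟩
      have : A' = ⟨mulRight B A, (mulRight_mem hB _).2 hA⟩ := Subtype.ext h
      subst this
      have hA'' : moebius (toGL ⟨mulRight B A, (mulRight_mem hB _).2 hA⟩) (northPole K) ∈ M := hA'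
      rw [toGL_mulRight ⟨A, hA⟩, moebius_mul] at hA''
      exact hA''
  simp only [f1, f2, lintegral_const, measure_univ, mul_one, hmS_univ] at e1 e2
  rw [← e1, e2]

/-- `projMeasure K` is the unique `PGL₂(R)`-invariant Borel probability measure on `ℙ¹(K)`. -/
theorem eq_projMeasure_iff [IsUltrametricDist K] (ν : Measure (ProjLine K)) :
    ν = projMeasure K ↔
      IsProbabilityMeasure ν ∧ ∀ A ∈ integralGL K, ν.map (moebius A) = ν := by
  constructor
  · rintro rfl
    exact ⟨inferInstance, fun A hA => projMeasure_map hA⟩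
  · rintro ⟨h1, h2⟩
    ext M hM
    refine (ENNReal.mul_left_inj (measure_intMatrices_ne_zero (K := K))
      measure_intMatrices_ne_top).1 ?_
    rw [invariant_apply ν h2 hM, invariant_apply _ (fun A (hA : A ∈ integralGL K) => projMeasure_map hA) hM]

end Uniqueness

/-! ### Partition functions

A tuple `(s i j)` indexed by `1 ≤ i < j ≤ N` is given as a function `s : Fin N → Fin N → ℂ`, of which
only the entries with `i < j` are ever used. -/

section Partition

/-- The integrand `∏_{i < j} d(x i, x j) ^ s i j`. -/
def gasIntegrand {X ι : Type*} [Fintype ι] [LinearOrder ι] (d : X → X → ℝ) (s : ι → ι → ℂ)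
    (x : ι → X) : ℂ :=
  ∏ p : ι × ι with p.1 < p.2, ((d (x p.1) (x p.2) : ℝ) : ℂ) ^ s p.1 p.2

/-- `Z_I(X, s)`, the integral over `X ^ I` for a subset `X` of `K` and `I ⊆ [N]`. For `I = ∅` the
product space is a point of mass one and the integrand is an empty product, so `Z_∅(X, s) = 1`. -/
def partitionFunction {K : Type*} [NontriviallyNormedField K] [LocallyCompactSpace K]
    [MeasurableSpace K] [BorelSpace K] {N : ℕ} (I : Finset (Fin N)) (X : Set K)
    (s : Fin N → Fin N → ℂ) : ℂ :=
  ∫ x in Set.univ.pi (fun _ : I => X), gasIntegrand (fun a b : K => ‖a - b‖)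
    (fun i j : I => s i j) x ∂(Measure.pi fun _ : I => haar K)

/-- The integrand of `Z_N(ℙ¹(K), s)`. -/
def projIntegrand (K : Type*) [NontriviallyNormedField K] {N : ℕ} (s : Fin N → Fin N → ℂ) :
    (Fin N → ProjLine K) → ℂ :=
  gasIntegrand sphericalDist s

/-- The product measure `ν ^ N` on `ℙ¹(K) ^ N`. -/
def projMeasurePow (K : Type*) [NontriviallyNormedField K] [LocallyCompactSpace K]
    [MeasurableSpace K] [BorelSpace K] (N : ℕ) : Measure (Fin N → ProjLine K) :=
  Measure.pi fun _ => projMeasure K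

/-- `Z_N(ℙ¹(K), s)`. -/
def projPartitionFunction (K : Type*) [NontriviallyNormedField K] [LocallyCompactSpace K]
    [MeasurableSpace K] [BorelSpace K] {N : ℕ} (s : Fin N → Fin N → ℂ) : ℂ :=
  ∫ x, projIntegrand K s x ∂(projMeasurePow K N)

/-- `e_J(s) = #J - 1 + ∑_{i < j, i ∈ J, j ∈ J} s i j`. -/
def branchExponent {N : ℕ} (J : Finset (Fin N)) (s : Fin N → Fin N → ℂ) : ℂ :=
  (J.card : ℂ) - 1 + ∑ p ∈ J ×ˢ J with p.1 < p.2, s p.1 p.2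

/-- `Ω_N`: all `s` with `Re e_J(s) > 0` for every `J ⊆ [N]` with more than one element. -/
def convergenceDomain (N : ℕ) : Set (Fin N → Fin N → ℂ) :=
  {s | ∀ J : Finset (Fin N), 1 < J.card → 0 < (branchExponent J s).re}

open scoped Classical in
/-- Ordered partitions `(I 0, …, I (m - 1))` of `[N]` into `m` pairwise disjoint, possibly empty,
parts. -/
def orderedPartitions (N m : ℕ) : Finset (Fin m → Finset (Fin N)) :=
  Finset.univ.filter fun I =>
    (∀ k l, k ≠ l → Disjoint (I k) (I l)) ∧ Finset.univ.biUnion I = Finset.univ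

end Partition

end LogCoulomb

end

open LogCoulomb

noncomputable section

namespace LogCoulomb

/-! ### Uniformizers and residue classes -/

section Residue

variable (K : Type*) [NontriviallyNormedField K] [IsUltrametricDist K]

theorem isUnit_intRing_iff (x : intRing K) : IsUnit x ↔ ‖(x : K)‖ = 1 :=
  Valued.integer.isUnit_iff_norm_eq_one

theorem residue_eq_iff (x y : intRing K) :
    IsLocalRing.residue (intRing K) x = IsLocalRing.residue (intRing K) y ↔
      ‖(x : K) - y‖ < 1 := by
  rw [← sub_eq_zero, ← map_sub, IsLocalRing.residue_eq_zero_iff, IsLocalRing.mem_maximalIdeal,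
    mem_nonunits_iff, isUnit_intRing_iff]
  have h : ‖((x - y : intRing K) : K)‖ ≤ 1 := (mem_intRing_iff K _).1 (x - y).2
  exact ⟨fun h' => lt_of_le_of_ne h h', fun h' => h'.ne⟩

variable [LocallyCompactSpace K]

instance : Finite (IsLocalRing.ResidueField (intRing K)) := by
  have : ProperSpace K := ProperSpace.of_locallyCompactSpace K
  obtain ⟨t, ht, htf, hcov⟩ := (isCompact_closedBall (0 : K) 1).finite_cover_balls one_pos
  have hmem : ∀ x : t, (x : K) ∈ intRing K := fun x =>
    (mem_intRing_iff K _).2 (by simpa using ht x.2)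
  have : Finite t := htf
  refine Finite.of_surjective
    (fun x : t => IsLocalRing.residue (intRing K) ⟨x, hmem x⟩) fun y => ?_
  obtain ⟨y, rfl⟩ := IsLocalRing.residue_surjective y
  have hy : (y : K) ∈ closedBall (0 : K) 1 := by simpa using (mem_intRing_iff K _).1 y.2
  obtain ⟨x, hx, hxy⟩ := Set.mem_iUnion₂.1 (hcov hy)
  refine ⟨⟨x, hx⟩, (residue_eq_iff K _ _).2 ?_⟩
  rwa [← dist_eq_norm, dist_comm]

theorem one_lt_residueCard : 1 < residueCard K := Finite.one_lt_card

/-- Representatives of the residue classes. -/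
theorem exists_representatives : ∃ r : Fin (residueCard K) → K,
    (∀ k, ‖r k‖ ≤ 1) ∧ ∀ x : K, ‖x‖ ≤ 1 → ∃! k, ‖x - r k‖ < 1 := by
  let e : IsLocalRing.ResidueField (intRing K) ≃ Fin (residueCard K) := Finite.equivFin _
  let σ := Function.surjInv (IsLocalRing.residue_surjective (R := intRing K))
  have hσ : ∀ y, IsLocalRing.residue (intRing K) (σ y) = y := Function.surjInv_eq _
  refine ⟨fun k => σ (e.symm k), fun k => (mem_intRing_iff K _).1 (σ (e.symm k)).2,
    fun x hx => ?_⟩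
  have key : ∀ k, ‖x - σ (e.symm k)‖ < 1 ↔
      k = e (IsLocalRing.residue _ ⟨x, (mem_intRing_iff K _).2 hx⟩) := fun k => by
    rw [← residue_eq_iff K ⟨x, (mem_intRing_iff K _).2 hx⟩, hσ]
    exact ⟨fun h => by rw [h, e.apply_symm_apply], fun h => by rw [h, e.symm_apply_apply]⟩
  exact ⟨_, (key _).2 rfl, fun k hk => (key k).1 hk⟩

variable {K}

theorem exists_uniformizer (hK : IsCanonicalNorm K) :
    ∃ ϖ : K, ‖ϖ‖ = (residueCard K : ℝ)⁻¹ ∧ ∀ x : K, ‖x‖ < 1 ↔ ‖x‖ ≤ ‖ϖ‖ := by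
  let := NormedField.toValued (K := K)
  have : ProperSpace K := ProperSpace.of_locallyCompactSpace K
  have hcl : ((intRing K : Subring K) : Set K) = closedBall 0 1 := by
    ext x
    rw [SetLike.mem_coe, mem_intRing_iff, mem_closedBall_zero_iff]
  have : CompactSpace (Valued.integer K) := by
    refine isCompact_iff_compactSpace.1 ?_
    change IsCompact ((intRing K : Subring K) : Set K)
    rw [hcl]
    exact isCompact_closedBall 0 1
  have : (Valued.v : Valuation K NNReal).IsNontrivial := by
    obtain ⟨x, hx0, hx1⟩ := NormedField.exists_norm_lt_one K
    refine ⟨x, ?_, ?_⟩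
    · simpa using hx0
    · intro h
      rw [NormedField.v_eq_valuation, NormedField.valuation_apply] at h
      exact hx1.ne (congrArg NNReal.toReal h)
  have : IsDiscreteValuationRing (Valued.integer K) :=
    Valued.integer.isDiscreteValuationRing_of_compactSpace
  obtain ⟨ϖ, hϖ⟩ := IsDiscreteValuationRing.exists_irreducible (Valued.integer K)
  have hlt : ‖(ϖ : K)‖ < 1 := Valued.integer.norm_irreducible_lt_one hϖ
  refine ⟨ϖ, hK ϖ hϖ, fun x => ⟨fun hx => ?_, fun hx => hx.trans_lt hlt⟩⟩
  have h := hϖ.maximalIdeal_eq_closedBall (K := K)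
  let y : Valued.integer K := ⟨x, (mem_intRing_iff K _).2 hx.le⟩
  have hy : y ∈ (IsLocalRing.maximalIdeal (Valued.integer K) : Set (Valued.integer K)) := by
    rw [SetLike.mem_coe, IsLocalRing.mem_maximalIdeal, mem_nonunits_iff]
    exact fun hu => hx.ne ((isUnit_intRing_iff K y).1 hu)
  have hy' := h.subset hy
  simpa using hy'

end Residue

/-! ### Finite products of measures -/

section PiMeasure

theorem lintegral_fin_prod {n : ℕ} {E : Fin n → Type*} [∀ k, MeasurableSpace (E k)]
    (m : ∀ k, Measure (E k)) [∀ k, SigmaFinite (m k)] (f : ∀ k, E k → ℝ≥0∞)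
    (hf : ∀ k, Measurable (f k)) :
    ∫⁻ x, ∏ k, f k (x k) ∂Measure.pi m = ∏ k, ∫⁻ x, f k x ∂m k := by
  induction n with
  | zero => simp
  | succ n ih =>
    have hg : Measurable fun x : ∀ k : Fin n, E k.succ => ∏ k : Fin n, f k.succ (x k) :=
      Finset.measurable_fun_prod _ fun k _ => (hf _).comp (measurable_pi_apply k)
    rw [← ((measurePreserving_piFinSuccAbove m 0).symm).lintegral_comp_emb
      (MeasurableEquiv.measurableEmbedding _), Fin.prod_univ_succ,
      ← ih (fun k => m k.succ) (fun k => f k.succ) (fun k => hf _),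
      ← lintegral_prod_mul (hf 0).aemeasurable hg.aemeasurable]
    simp_rw [MeasurableEquiv.piFinSuccAbove_symm_apply, Fin.insertNthEquiv,
      Fin.prod_univ_succ, Fin.insertNth_zero]
    rfl

theorem lintegral_fintype_prod {κ : Type*} [Fintype κ] {E : κ → Type*}
    [∀ k, MeasurableSpace (E k)] (m : ∀ k, Measure (E k)) [∀ k, SigmaFinite (m k)]
    (f : ∀ k, E k → ℝ≥0∞) (hf : ∀ k, Measurable (f k)) :
    ∫⁻ x, ∏ k, f k (x k) ∂Measure.pi m = ∏ k, ∫⁻ x, f k x ∂m k := by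
  let e := (Fintype.equivFin κ).symm
  rw [← (measurePreserving_piCongrLeft m e).lintegral_comp_emb
    (MeasurableEquiv.measurableEmbedding _)]
  simp_rw [← e.prod_comp, MeasurableEquiv.coe_piCongrLeft, Equiv.piCongrLeft_apply_apply]
  exact lintegral_fin_prod (fun k => m (e k)) (fun k => f (e k)) fun k => hf _

variable {ι κ X Y : Type*} [Fintype ι] [MeasurableSpace X] [MeasurableSpace Y]

theorem pi_const_smul (c : ℝ≥0∞) (hc : c ≠ ⊤) (m : Measure X) [SigmaFinite m] :
    (Measure.pi fun _ : ι => c • m) = c ^ Fintype.card ι • Measure.pi fun _ : ι => m := by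
  have : SigmaFinite (c • m) := by
    lift c to NNReal using hc
    exact inferInstanceAs (SigmaFinite (c • m))
  refine Measure.pi_eq fun s _ => ?_
  simp [Measure.smul_apply, Measure.pi_pi, Finset.prod_mul_distrib]

theorem pi_map_const (m : Measure X) [IsFiniteMeasure m] {φ : X → Y} (hφ : Measurable φ) :
    (Measure.pi fun _ : ι => m.map φ) =
      (Measure.pi fun _ : ι => m).map fun x i => φ (x i) :=
  (Measure.pi_map_pi fun _ => hφ.aemeasurable).symm

/-- The product of a sum of image measures is a sum, over all choices of a summand in every
coordinate, of image measures. -/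
theorem pi_sum_map [Fintype κ] [DecidableEq ι] (m : Measure X) [IsFiniteMeasure m]
    {φ : κ → X → Y} (hφ : ∀ k, Measurable (φ k)) :
    (Measure.pi fun _ : ι => ∑ k, m.map (φ k)) =
      ∑ f : ι → κ, (Measure.pi fun _ : ι => m).map fun x i => φ (f i) (x i) := by
  refine Measure.pi_eq fun s _ => ?_
  simp only [Measure.coe_finsetSum, Finset.sum_apply]
  rw [Finset.prod_univ_sum]
  refine Finset.sum_congr (by ext; simp) fun f _ => ?_
  rw [Measure.pi_map_pi fun i => (hφ (f i)).aemeasurable, Measure.pi_pi]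

/-- The indices which `f` sends to `k`. -/
def fiber [DecidableEq κ] (f : ι → κ) (k : κ) : Finset ι := Finset.univ.filter fun i => f i = k

@[simp]
theorem mem_fiber [DecidableEq κ] {f : ι → κ} {k : κ} {i : ι} : i ∈ fiber f k ↔ f i = k := by
  simp [fiber]

/-- Regrouping the coordinates of a tuple according to the values of `f`. -/
def groupFibers [DecidableEq κ] (f : ι → κ) : (ι → X) ≃ᵐ (∀ k, fiber f k → X) where
  toFun x k i := x i
  invFun y i := y (f i) ⟨i, mem_fiber.2 rfl⟩
  left_inv x := rfl
  right_inv y := by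
    ext k ⟨i, hi⟩
    obtain rfl := mem_fiber.1 hi
    rfl
  measurable_toFun := measurable_pi_lambda _ fun k => measurable_pi_lambda _ fun i =>
    measurable_pi_apply _
  measurable_invFun := by
    refine measurable_pi_lambda _ fun i => ?_
    exact (measurable_pi_apply (⟨i, mem_fiber.2 rfl⟩ : fiber f (f i))).comp
      (measurable_pi_apply (f i))

theorem measurePreserving_groupFibers [Fintype κ] [DecidableEq κ] (f : ι → κ) (m : Measure X)
    [SigmaFinite m] :
    MeasurePreserving (groupFibers f) (Measure.pi fun _ : ι => m)
      (Measure.pi fun k => Measure.pi fun _ : fiber f k => m) := by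
  refine MeasurePreserving.symm (groupFibers f).symm ⟨(groupFibers f).symm.measurable, ?_⟩
  refine (Measure.pi_eq fun s hs => ?_).symm
  rw [MeasurableEquiv.map_apply]
  have : (groupFibers f).symm ⁻¹' (Set.univ.pi s) =
      Set.univ.pi fun k => Set.univ.pi fun i : fiber f k => s i := by
    ext y
    simp only [Set.mem_preimage, Set.mem_univ_pi]
    refine ⟨fun h k i => ?_, fun h i => h (f i) ⟨i, _⟩⟩
    obtain ⟨i, hi⟩ := i
    obtain rfl := mem_fiber.1 hi
    exact h i
  rw [this, Measure.pi_pi]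
  simp_rw [Measure.pi_pi]
  rw [← Finset.prod_fiberwise (s := Finset.univ) (g := f)]
  exact Finset.prod_congr rfl fun k _ => Finset.prod_coe_sort (fiber f k) fun i => m (s i)

theorem lintegral_prod_fibers [Fintype κ] [DecidableEq κ] (f : ι → κ) (m : Measure X)
    [SigmaFinite m] (h : ∀ k, (fiber f k → X) → ℝ≥0∞) (hh : ∀ k, Measurable (h k)) :
    ∫⁻ x, ∏ k, h k (fun i => x i) ∂Measure.pi (fun _ : ι => m) =
      ∏ k, ∫⁻ y, h k y ∂Measure.pi fun _ : fiber f k => m := by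
  rw [← lintegral_fintype_prod _ _ hh, ← (measurePreserving_groupFibers f m).lintegral_comp_emb
    (groupFibers f).measurableEmbedding]
  rfl

theorem integral_prod_fibers [Fintype κ] [DecidableEq κ] (f : ι → κ) (m : Measure X)
    [SigmaFinite m] (h : ∀ k, (fiber f k → X) → ℂ) :
    ∫ x, ∏ k, h k (fun i => x i) ∂Measure.pi (fun _ : ι => m) =
      ∏ k, ∫ y, h k y ∂Measure.pi fun _ : fiber f k => m := by
  rw [← integral_fintype_prod_eq_prod h, ← (measurePreserving_groupFibers f m).integral_comp
    (groupFibers f).measurableEmbedding]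
  rfl

end PiMeasure

/-! ### Haar measure on the valuation ring and on its maximal ideal -/

theorem setOf_norm_lt_one {K : Type*} [SeminormedAddCommGroup K] :
    {x : K | ‖x‖ < 1} = ball 0 1 := by
  ext
  simp

theorem measurableSet_norm_lt_one {K : Type*} [SeminormedAddCommGroup K] [MeasurableSpace K]
    [OpensMeasurableSpace K] : MeasurableSet {x : K | ‖x‖ < 1} := by
  rw [setOf_norm_lt_one]
  exact isOpen_ball.measurableSet

section Haar

variable {K : Type*} [NontriviallyNormedField K] [LocallyCompactSpace K] [MeasurableSpace K]
  [BorelSpace K]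

variable (K) in
/-- Haar measure on the valuation ring `R`. -/
def haarR : Measure K := (haar K).restrict (closedBall 0 1)

variable (K) in
/-- Haar measure on the maximal ideal `P`. -/
def haarP : Measure K := (haar K).restrict {x | ‖x‖ < 1}

instance : IsProbabilityMeasure (haarR K) := ⟨by simp [haarR, haar_closedBall]⟩

instance : IsFiniteMeasure (haarP K) := by
  refine ⟨?_⟩
  rw [haarP, Measure.restrict_apply_univ, setOf_norm_lt_one]
  exact (measure_mono ball_subset_closedBall).trans_lt (by rw [haar_closedBall]; simp)

theorem haar_translate (c : K) : (haar K).map (c + ·) = haar K := map_add_left_eq_self _ _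

theorem exists_haar_map_mul {c : K} (hc : c ≠ 0) :
    ∃ a : ℝ≥0∞, (haar K).map (c * ·) = a • haar K := by
  have : ProperSpace K := ProperSpace.of_locallyCompactSpace K
  have h1 : ((haar K).map
      (ContinuousLinearEquiv.unitsEquivAut K (Units.mk0 c hc))).IsAddHaarMeasure :=
    ContinuousLinearEquiv.isAddHaarMeasure_map _ _
  have h2 : ⇑(ContinuousLinearEquiv.unitsEquivAut K (Units.mk0 c hc)) = (c * ·) := by
    ext x
    simp [mul_comm]
  rw [h2] at h1
  exact ⟨_, Measure.isAddLeftInvariant_eq_smul _ _⟩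

theorem haar_map_unit {u : K} (hu : ‖u‖ = 1) : (haar K).map (u * ·) = haar K := by
  have hu0 : u ≠ 0 := norm_ne_zero_iff.1 (by simp [hu])
  have hm : Measurable (u * · : K → K) := (continuous_const_mul u).measurable
  have hpre : (u * · : K → K) ⁻¹' closedBall 0 1 = closedBall 0 1 := by ext; simp [hu]
  obtain ⟨a, ha⟩ := exists_haar_map_mul hu0
  have h := congrArg (fun m : Measure K => m (closedBall 0 1)) ha
  simp only [Measure.map_apply hm isClosed_closedBall.measurableSet, hpre, haar_closedBall,
    Measure.smul_apply, smul_eq_mul, mul_one] at h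
  rw [ha, ← h, one_smul]

theorem haarR_map_unit {u : K} (hu : ‖u‖ = 1) : (haarR K).map (u * ·) = haarR K := by
  have hm : Measurable (u * · : K → K) := (continuous_const_mul u).measurable
  have hpre : (u * · : K → K) ⁻¹' closedBall 0 1 = closedBall 0 1 := by ext; simp [hu]
  rw [haarR]
  conv_lhs => rw [← hpre]
  rw [← Measure.restrict_map hm isClosed_closedBall.measurableSet, haar_map_unit hu]

theorem haarP_map_unit {u : K} (hu : ‖u‖ = 1) : (haarP K).map (u * ·) = haarP K := by
  have hm : Measurable (u * · : K → K) := (continuous_const_mul u).measurable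
  have hpre : (u * · : K → K) ⁻¹' {x | ‖x‖ < 1} = {x | ‖x‖ < 1} := by ext; simp [hu]
  rw [haarP]
  conv_lhs => rw [← hpre]
  rw [← Measure.restrict_map hm measurableSet_norm_lt_one, haar_map_unit hu]

variable [IsUltrametricDist K]

theorem haarR_eq_sum {n : ℕ} {r : Fin n → K} (hr : ∀ k, ‖r k‖ ≤ 1)
    (hr' : ∀ x : K, ‖x‖ ≤ 1 → ∃! k, ‖x - r k‖ < 1) :
    haarR K = ∑ k, (haarP K).map (r k + ·) := by
  have hm : ∀ c : K, Measurable (c + · : K → K) := fun c => (continuous_const_add c).measurable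
  have hs : ∀ k, MeasurableSet {x : K | ‖x - r k‖ < 1} := fun k =>
    (isOpen_lt (by fun_prop) continuous_const).measurableSet
  have hle : ∀ k (x : K), ‖x - r k‖ < 1 → ‖x‖ ≤ 1 := fun k x hx => by
    have := IsUltrametricDist.norm_add_le_max (x - r k) (r k)
    rw [sub_add_cancel] at this
    exact this.trans (max_le hx.le (hr k))
  have hU : closedBall (0 : K) 1 = ⋃ k, {x : K | ‖x - r k‖ < 1} := by
    ext x
    simp only [mem_closedBall_zero_iff, Set.mem_iUnion, Set.mem_ofPred_eq]
    exact ⟨fun hx => (hr' x hx).exists, fun ⟨k, hk⟩ => hle k x hk⟩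
  have hd : Pairwise (Function.onFun Disjoint fun k => {x : K | ‖x - r k‖ < 1}) :=
    fun k l hkl => Set.disjoint_left.2 fun x hx hx' =>
      hkl ((hr' x (hle k x hx)).unique hx hx')
  rw [haarR, hU, Measure.restrict_iUnion hd hs, Measure.sum_fintype]
  refine Finset.sum_congr rfl fun k _ => ?_
  have hpre : (r k + ·) ⁻¹' {x : K | ‖x - r k‖ < 1} = {x : K | ‖x‖ < 1} := by ext; simp
  rw [haarP, ← hpre, ← Measure.restrict_map (hm _) (hs k), haar_translate]

theorem haarP_univ : haarP K Set.univ = (residueCard K : ℝ≥0∞)⁻¹ := by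
  obtain ⟨r, hr, hr'⟩ := exists_representatives K
  have h := congrArg (fun m : Measure K => m Set.univ) (haarR_eq_sum hr hr')
  have h' : ∀ k, (haarP K).map (r k + ·) Set.univ = haarP K Set.univ := fun k => by
    rw [Measure.map_apply (continuous_const_add _).measurable MeasurableSet.univ,
      Set.preimage_univ]
  simp only [measure_univ, Measure.coe_finsetSum, Finset.sum_apply, h', Finset.sum_const,
    Finset.card_univ, Fintype.card_fin, nsmul_eq_mul] at h
  exact ENNReal.eq_inv_of_mul_eq_one_left (by rw [h, mul_comm])

theorem haarP_eq_map {ϖ : K} (h0 : ϖ ≠ 0) (hϖ : ∀ x : K, ‖x‖ < 1 ↔ ‖x‖ ≤ ‖ϖ‖) :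
    haarP K = (residueCard K : ℝ≥0∞)⁻¹ • (haarR K).map (ϖ * ·) := by
  have hm : Measurable (ϖ * · : K → K) := (continuous_const_mul ϖ).measurable
  have hpre : (ϖ * · : K → K) ⁻¹' {x | ‖x‖ < 1} = closedBall 0 1 := by
    ext x
    simp only [Set.mem_preimage, Set.mem_ofPred_eq, mem_closedBall_zero_iff, hϖ, norm_mul]
    exact mul_le_iff_le_one_right (norm_pos_iff.2 h0)
  obtain ⟨a, ha⟩ := exists_haar_map_mul h0
  have hP : (haarR K).map (ϖ * ·) = a • haarP K := by
    rw [haarR, ← hpre, ← Measure.restrict_map hm measurableSet_norm_lt_one, ha,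
      Measure.restrict_smul, haarP]
  have h := congrArg (fun m : Measure K => m Set.univ) hP
  simp only [Measure.map_apply hm MeasurableSet.univ, Set.preimage_univ, measure_univ,
    Measure.smul_apply, haarP_univ, smul_eq_mul] at h
  rw [hP, smul_smul, mul_comm, ← h, one_smul]

end Haar

/-! ### Algebra of the integrand -/

section Gas

theorem cpow_sum {α : Type*} (t : Finset α) (g : α → ℂ) {c : ℂ} (hc : c ≠ 0) :
    c ^ ∑ a ∈ t, g a = ∏ a ∈ t, c ^ g a := by
  classical
  induction t using Finset.induction_on with
  | empty => simp
  | insert a t ha ih =>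
    rw [Finset.sum_insert ha, Finset.prod_insert ha, Complex.cpow_add _ _ hc, ih]

variable {ι : Type*} [LinearOrder ι]

@[to_additive]
theorem prod_pairs_coe {M : Type*} [CommMonoid M] (J : Finset ι) (g : ι → ι → M) :
    ∏ p : J × J with p.1 < p.2, g p.1 p.2 = ∏ p ∈ J ×ˢ J with p.1 < p.2, g p.1 p.2 := by
  refine Finset.prod_bij' (fun p _ => (p.1.1, p.2.1))
    (fun p hp => (⟨p.1, (Finset.mem_product.1 (Finset.mem_filter.1 hp).1).1⟩,
      ⟨p.2, (Finset.mem_product.1 (Finset.mem_filter.1 hp).1).2⟩)) ?_ ?_ ?_ ?_ ?_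
  · rintro ⟨⟨i, hi⟩, ⟨j, hj⟩⟩ hp
    simpa [hi, hj] using hp
  · rintro ⟨i, j⟩ hp
    simpa using (Finset.mem_filter.1 hp).2
  all_goals intros; rfl

/-- The sum of `s i j` over the pairs `i < j` in `J`. -/
def pairSum (J : Finset ι) (s : ι → ι → ℂ) : ℂ := ∑ p ∈ J ×ˢ J with p.1 < p.2, s p.1 p.2

theorem pairSum_coe (J : Finset ι) (J' : Finset J) (s : ι → ι → ℂ) :
    pairSum J' (fun i j : J => s i j) = pairSum (J'.map (Function.Embedding.subtype _)) s := by
  simp only [pairSum, Finset.sum_filter, Finset.sum_product, Finset.sum_map]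
  rfl

theorem pairSum_univ_coe (J : Finset ι) (s : ι → ι → ℂ) :
    pairSum (Finset.univ : Finset J) (fun i j : J => s i j) = pairSum J s := by
  rw [pairSum, Finset.univ_product_univ, sum_pairs_coe J fun i j => s i j, pairSum]

variable [Fintype ι]

/-- If points in different cells have distance one, the integrand factors over the cells. -/
theorem gasIntegrand_eq_prod_fibers {X Y κ : Type*} [Fintype κ] [DecidableEq κ]
    (d : X → X → ℝ) (d' : Y → Y → ℝ) (s : ι → ι → ℂ) (f : ι → κ) (x : ι → X) (y : ι → Y)
    (h : ∀ i j, f i = f j → d (x i) (x j) = d' (y i) (y j))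
    (h' : ∀ i j, f i ≠ f j → d (x i) (x j) = 1) :
    gasIntegrand d s x =
      ∏ k, gasIntegrand d' (fun i j : fiber f k => s i j) (fun i : fiber f k => y i) := by
  have key : ∀ k, gasIntegrand d' (fun i j : fiber f k => s i j) (fun i : fiber f k => y i) =
      ∏ p : ι × ι with p.1 < p.2,
        if f p.1 = k ∧ f p.2 = k then ((d' (y p.1) (y p.2) : ℝ) : ℂ) ^ s p.1 p.2 else 1 := by
    intro k
    rw [gasIntegrand, prod_pairs_coe (fiber f k) fun i j => ((d' (y i) (y j) : ℝ) : ℂ) ^ s i j,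
      ← Finset.prod_filter, Finset.filter_filter]
    refine Finset.prod_congr ?_ fun _ _ => rfl
    ext ⟨i, j⟩
    simp [and_comm]
  simp_rw [key]
  rw [Finset.prod_comm, gasIntegrand]
  refine Finset.prod_congr rfl fun p _ => ?_
  by_cases hp : f p.1 = f p.2
  · rw [Finset.prod_eq_single (f p.2)]
    · rw [if_pos ⟨hp, rfl⟩, h _ _ hp]
    · intro k _ hk
      rw [if_neg fun hk' => hk hk'.2.symm]
    · simp
  · rw [h' _ _ hp, Finset.prod_eq_one]
    · simp
    · intro k _
      rw [if_neg fun hk => hp (hk.1.trans hk.2.symm)]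

theorem gasIntegrand_of_card_le_one {X : Type*} (hι : Fintype.card ι ≤ 1) (d : X → X → ℝ)
    (s : ι → ι → ℂ) (x : ι → X) : gasIntegrand d s x = 1 := by
  have := Fintype.card_le_one_iff_subsingleton.1 hι
  refine Finset.prod_eq_one fun p hp => ?_
  exact absurd (Subsingleton.elim p.1 p.2) (Finset.mem_filter.1 hp).2.ne

variable {K : Type*} [NontriviallyNormedField K]

/-- The integrand `∏_{i < j} |x i - x j| ^ s i j`. -/
def fieldIntegrand (s : ι → ι → ℂ) (x : ι → K) : ℂ := gasIntegrand (fun a b : K => ‖a - b‖) s x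

theorem fieldIntegrand_add (s : ι → ι → ℂ) (x : ι → K) (c : K) :
    fieldIntegrand s (fun i => c + x i) = fieldIntegrand s x := by
  simp [fieldIntegrand, gasIntegrand]

theorem fieldIntegrand_mul (s : ι → ι → ℂ) (x : ι → K) {c : K} (hc : c ≠ 0) :
    fieldIntegrand s (fun i => c * x i) =
      ((‖c‖ : ℝ) : ℂ) ^ pairSum Finset.univ s * fieldIntegrand s x := by
  have hc' : ((‖c‖ : ℝ) : ℂ) ≠ 0 := by simpa using hc
  simp only [fieldIntegrand, gasIntegrand, ← mul_sub, norm_mul, Complex.ofReal_mul]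
  rw [pairSum, Finset.univ_product_univ, cpow_sum _ _ hc', ← Finset.prod_mul_distrib]
  refine Finset.prod_congr rfl fun p _ => ?_
  rw [Complex.mul_cpow_ofReal_nonneg (norm_nonneg _) (norm_nonneg _)]

theorem fieldIntegrand_ne_zero (s : ι → ι → ℂ) {x : ι → K} (hx : Function.Injective x) :
    fieldIntegrand s x ≠ 0 := by
  refine Finset.prod_ne_zero_iff.2 fun p hp => ?_
  have h : x p.1 ≠ x p.2 := hx.ne (Finset.mem_filter.1 hp).2.ne
  rw [Complex.cpow_ne_zero_iff]
  simp [sub_eq_zero, h]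

theorem measurable_fieldIntegrand [LocallyCompactSpace K] [MeasurableSpace K] [BorelSpace K]
    (s : ι → ι → ℂ) : Measurable (fieldIntegrand s : (ι → K) → ℂ) := by
  have : ProperSpace K := ProperSpace.of_locallyCompactSpace K
  refine Finset.measurable_fun_prod _ fun p _ => ?_
  refine Measurable.pow_const (Complex.measurable_ofReal.comp ?_) _
  exact (((measurable_pi_apply p.1).sub (measurable_pi_apply p.2))).norm

end Gas

/-! ### Distances between coordinates -/

section Spread

variable {K ι : Type*} [NontriviallyNormedField K] [Fintype ι]

/-- The largest distance between two coordinates. -/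
def spread (x : ι → K) : ℝ := ‖fun p : ι × ι => x p.1 - x p.2‖

theorem spread_nonneg (x : ι → K) : 0 ≤ spread x := norm_nonneg _

theorem norm_sub_le_spread (x : ι → K) (i j : ι) : ‖x i - x j‖ ≤ spread x :=
  norm_le_pi_norm (fun p : ι × ι => x p.1 - x p.2) (i, j)

theorem spread_le_iff {x : ι → K} {a : ℝ} (ha : 0 ≤ a) :
    spread x ≤ a ↔ ∀ i j, ‖x i - x j‖ ≤ a := by
  rw [spread, pi_norm_le_iff_of_nonneg ha, Prod.forall]

theorem spread_add (x : ι → K) (c : K) : spread (fun i => c + x i) = spread x := by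
  simp [spread]

theorem spread_mul (x : ι → K) (c : K) : spread (fun i => c * x i) = ‖c‖ * spread x := by
  rw [spread, spread, ← norm_smul]
  congr 1
  ext p
  simp [mul_sub]

variable [IsUltrametricDist K]

theorem norm_sub_le_max_norm (x y : K) : ‖x - y‖ ≤ max ‖x‖ ‖y‖ := by
  simpa [sub_eq_add_neg] using IsUltrametricDist.norm_add_le_max x (-y)

theorem spread_le_one {x : ι → K} (hx : ∀ i, ‖x i‖ ≤ 1) : spread x ≤ 1 :=
  (spread_le_iff zero_le_one).2 fun i j =>
    (norm_sub_le_max_norm _ _).trans (max_le (hx i) (hx j))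

theorem norm_add_sub_add_of_ne {n : ℕ} {r : Fin n → K} (hr : ∀ k, ‖r k‖ ≤ 1)
    (hr' : ∀ x : K, ‖x‖ ≤ 1 → ∃! k, ‖x - r k‖ < 1) {k l : Fin n} (hkl : k ≠ l) {x y : K}
    (hx : ‖x‖ < 1) (hy : ‖y‖ < 1) : ‖(r k + x) - (r l + y)‖ = 1 := by
  have h1 : ‖r k - r l‖ = 1 := by
    refine le_antisymm ((norm_sub_le_max_norm _ _).trans (max_le (hr k) (hr l))) ?_
    by_contra h
    exact hkl ((hr' (r k) (hr k)).unique (by simp) (not_le.1 h))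
  have h2 : ‖x - y‖ < 1 := (norm_sub_le_max_norm _ _).trans_lt (max_lt hx hy)
  rw [show r k + x - (r l + y) = (r k - r l) + (x - y) by ring,
    IsUltrametricDist.norm_add_eq_max_of_norm_ne_norm (by rw [h1]; exact h2.ne'), h1,
    max_eq_left h2.le]

end Spread

/-! ### Decomposition and scaling of integrals over `R ^ ι` and `P ^ ι` -/

section Scaling

variable (K : Type*) [NontriviallyNormedField K] [LocallyCompactSpace K] [MeasurableSpace K]
  [BorelSpace K] (ι : Type*) [Fintype ι]

/-- Haar measure on `R ^ ι`. -/
def haarPowR : Measure (ι → K) := Measure.pi fun _ => haarR K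

/-- Haar measure on `P ^ ι`. -/
def haarPowP : Measure (ι → K) := Measure.pi fun _ => haarP K

instance : IsProbabilityMeasure (haarPowR K ι) := by unfold haarPowR; infer_instance

instance : IsFiniteMeasure (haarPowP K ι) := by unfold haarPowP; infer_instance

theorem haarPowR_eq_restrict : haarPowR K ι =
    (Measure.pi fun _ : ι => haar K).restrict (Set.univ.pi fun _ => closedBall 0 1) :=
  (Measure.restrict_pi_pi _ _).symm

theorem haarPowP_eq_restrict : haarPowP K ι =
    (Measure.pi fun _ : ι => haar K).restrict (Set.univ.pi fun _ => {x | ‖x‖ < 1}) :=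
  (Measure.restrict_pi_pi _ _).symm

theorem ae_norm_lt_one_haarPowP : ∀ᵐ x ∂haarPowP K ι, ∀ i, ‖x i‖ < 1 := by
  rw [haarPowP_eq_restrict]
  filter_upwards [ae_restrict_mem (MeasurableSet.univ_pi fun _ =>
    measurableSet_norm_lt_one)] with x hx i
  exact hx i (Set.mem_univ i)

theorem ae_norm_le_one_haarPowR : ∀ᵐ x ∂haarPowR K ι, ∀ i, ‖x i‖ ≤ 1 := by
  rw [haarPowR_eq_restrict]
  filter_upwards [ae_restrict_mem (MeasurableSet.univ_pi fun _ =>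
    isClosed_closedBall.measurableSet)] with x hx i
  simpa using hx i (Set.mem_univ i)

variable {K ι} [IsUltrametricDist K]

theorem lintegral_haarPowR [DecidableEq ι] {n : ℕ} {r : Fin n → K} (hr : ∀ k, ‖r k‖ ≤ 1)
    (hr' : ∀ x : K, ‖x‖ ≤ 1 → ∃! k, ‖x - r k‖ < 1) {g : (ι → K) → ℝ≥0∞} (hg : Measurable g) :
    ∫⁻ x, g x ∂haarPowR K ι =
      ∑ f : ι → Fin n, ∫⁻ x, g (fun i => r (f i) + x i) ∂haarPowP K ι := by
  have hm : ∀ k, Measurable (r k + · : K → K) := fun k => (continuous_const_add _).measurable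
  rw [haarPowR, haarR_eq_sum hr hr', pi_sum_map _ hm, lintegral_finsetSum_measure]
  refine Finset.sum_congr rfl fun f _ => lintegral_map hg ?_
  exact measurable_pi_lambda _ fun i => (hm _).comp (measurable_pi_apply i)

theorem haarPowP_eq_map {ϖ : K} (h0 : ϖ ≠ 0) (hϖ : ∀ x : K, ‖x‖ < 1 ↔ ‖x‖ ≤ ‖ϖ‖) :
    haarPowP K ι = ((residueCard K : ℝ≥0∞)⁻¹) ^ Fintype.card ι •
      (haarPowR K ι).map fun x i => ϖ * x i := by
  have hm : Measurable (ϖ * · : K → K) := (continuous_const_mul ϖ).measurable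
  have hq : (residueCard K : ℝ≥0∞)⁻¹ ≠ ⊤ := by
    have := one_lt_residueCard K
    simp
    omega
  have : IsFiniteMeasure ((haarR K).map (ϖ * ·)) := inferInstance
  rw [haarPowP, haarP_eq_map h0 hϖ, pi_const_smul _ hq, pi_map_const _ hm, haarPowR]

theorem lintegral_haarPowP {ϖ : K} (h0 : ϖ ≠ 0) (hϖ : ∀ x : K, ‖x‖ < 1 ↔ ‖x‖ ≤ ‖ϖ‖)
    {g : (ι → K) → ℝ≥0∞} (hg : Measurable g) :
    ∫⁻ x, g x ∂haarPowP K ι = ((residueCard K : ℝ≥0∞)⁻¹) ^ Fintype.card ι *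
      ∫⁻ x, g (fun i => ϖ * x i) ∂haarPowR K ι := by
  rw [haarPowP_eq_map h0 hϖ, lintegral_smul_measure, lintegral_map hg, smul_eq_mul]
  exact measurable_pi_lambda _ fun i => (measurable_pi_apply i).const_mul _

theorem measurable_spread : Measurable (spread : (ι → K) → ℝ) := by
  have : ProperSpace K := ProperSpace.of_locallyCompactSpace K
  have : Continuous (spread : (ι → K) → ℝ) := by
    unfold spread
    fun_prop
  exact this.measurable

/-- An integral over `R ^ ι` of a function which is invariant under diagonal translations and which
vanishes unless all coordinates are congruent modulo `P`, in terms of a rescaled function. -/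
theorem lintegral_haarPowR_rescale [Nonempty ι] {ϖ : K} (h0 : ϖ ≠ 0)
    (hϖ : ∀ x : K, ‖x‖ < 1 ↔ ‖x‖ ≤ ‖ϖ‖) {g : (ι → K) → ℝ≥0∞} (hg : Measurable g)
    (hadd : ∀ x c, g (fun i => c + x i) = g x) (hzero : ∀ x, 1 ≤ spread x → g x = 0) :
    ∫⁻ x, g x ∂haarPowR K ι =
      residueCard K * ((residueCard K : ℝ≥0∞)⁻¹) ^ Fintype.card ι *
        ∫⁻ x, g (fun i => ϖ * x i) ∂haarPowR K ι := by
  classical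
  obtain ⟨r, hr, hr'⟩ := exists_representatives K
  rw [lintegral_haarPowR hr hr' hg, mul_assoc, ← lintegral_haarPowP h0 hϖ hg]
  rw [← Finset.sum_of_injOn (s := Finset.univ) (Function.const ι)
    (f := fun _ => ∫⁻ x, g x ∂haarPowP K ι)
    (fun a _ b _ h => Function.const_injective h) (by simp) ?_ ?_]
  · simp
  · intro f _ hf
    have : ∃ i j, f i ≠ f j := by
      by_contra! h
      refine hf ⟨f (Classical.arbitrary ι), by simp, ?_⟩
      ext i
      rw [Function.const_apply, h i]
    obtain ⟨i, j, hij⟩ := this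
    refine (lintegral_congr_ae ?_).trans lintegral_zero
    filter_upwards [ae_norm_lt_one_haarPowP K ι] with x hx
    refine hzero _ ?_
    rw [← norm_add_sub_add_of_ne hr hr' hij (hx i) (hx j)]
    exact norm_sub_le_spread (fun i => r (f i) + x i) i j
  · intro k _
    simp [hadd]

theorem haarPowR_spread_eq_zero (hι : 1 < Fintype.card ι) {ϖ : K} (h0 : ϖ ≠ 0)
    (hϖ : ∀ x : K, ‖x‖ < 1 ↔ ‖x‖ ≤ ‖ϖ‖) : haarPowR K ι {x | spread x = 0} = 0 := by
  have : Nonempty ι := Fintype.card_pos_iff.1 (by omega)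
  have hs : MeasurableSet {x : ι → K | spread x = 0} :=
    measurable_spread (measurableSet_singleton 0)
  have hc : ‖ϖ‖ ≠ 0 := norm_ne_zero_iff.2 h0
  have h := lintegral_haarPowR_rescale h0 hϖ (g := {x : ι → K | spread x = 0}.indicator 1)
    (measurable_one.indicator hs) (fun x c => by simp [Set.indicator, spread_add])
    (fun x hx => Set.indicator_of_notMem (s := {x : ι → K | spread x = 0})
      (fun hx' : spread x = 0 => by linarith) _)
  have h1 : ∀ x : ι → K, {x : ι → K | spread x = 0}.indicator (1 : (ι → K) → ℝ≥0∞)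
      (fun i => ϖ * x i) = {x : ι → K | spread x = 0}.indicator 1 x := fun x => by
    simp [Set.indicator, spread_mul, h0]
  simp only [h1, lintegral_indicator_one hs] at h
  by_contra hne
  have h2 : (residueCard K : ℝ≥0∞) * ((residueCard K : ℝ≥0∞)⁻¹) ^ Fintype.card ι < 1 := by
    have hq := one_lt_residueCard K
    have hq0 : (residueCard K : ℝ≥0∞) ≠ 0 := by simp; omega
    obtain ⟨n, hn⟩ := Nat.exists_eq_add_of_lt hι
    rw [hn, show 1 + n + 1 = 1 + (n + 1) by ring, pow_add, pow_one, ← mul_assoc,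
      ENNReal.mul_inv_cancel hq0 (ENNReal.natCast_ne_top _), one_mul]
    refine pow_lt_one₀ zero_le (ENNReal.inv_lt_one.2 ?_) (Nat.succ_ne_zero n)
    exact_mod_cast hq
  have h3 := ENNReal.mul_lt_mul_left hne (measure_ne_top _ _) h2
  rw [one_mul, ← h] at h3
  exact h3.false

end Scaling

/-! ### Shells -/

section Shell

variable {K : Type*} [NontriviallyNormedField K] {ι : Type*} [Fintype ι]

/-- The tuples whose largest distance is `‖ϖ‖ ^ n` (for a uniformizer `ϖ`). -/
def shell (ϖ : K) (n : ℕ) : Set (ι → K) := {x | ‖ϖ‖ ^ (n + 1) < spread x ∧ spread x ≤ ‖ϖ‖ ^ n}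

theorem disjoint_shell {ϖ : K} (h1 : ‖ϖ‖ < 1) :
    Pairwise (Function.onFun Disjoint fun n => (shell ϖ n : Set (ι → K))) := by
  have key : ∀ m n : ℕ, m < n → Disjoint (shell ϖ m : Set (ι → K)) (shell ϖ n) := fun m n hmn =>
    Set.disjoint_left.2 fun x hx hx' => by
      have := pow_le_pow_of_le_one (norm_nonneg ϖ) h1.le hmn
      exact absurd (hx.1.trans_le hx'.2) (not_lt.2 this)
  intro m n hmn
  rcases lt_or_gt_of_ne hmn with h | h
  exacts [key m n h, (key n m h).symm]

theorem exists_mem_shell {ϖ : K} (h0 : ϖ ≠ 0) (h1 : ‖ϖ‖ < 1) {x : ι → K} (hx : spread x ≤ 1)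
    (hx0 : spread x ≠ 0) : ∃ n, x ∈ shell ϖ n :=
  exists_nat_pow_near_of_lt_one (lt_of_le_of_ne (spread_nonneg x) hx0.symm) hx
    (norm_pos_iff.2 h0) h1

/-- The factor by which the integral over a shell shrinks at each step. -/
def shellRatio (K : Type*) [NontriviallyNormedField K] [IsUltrametricDist K] [LinearOrder ι]
    (s : ι → ι → ℂ) : ℝ≥0∞ :=
  ENNReal.ofReal ((residueCard K : ℝ) ^ (-((Fintype.card ι : ℝ) - 1 + (pairSum Finset.univ s).re)))

variable [IsUltrametricDist K] [LocallyCompactSpace K] [LinearOrder ι]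

theorem enorm_fieldIntegrand_mul {ϖ : K} (hq : ‖ϖ‖ = (residueCard K : ℝ)⁻¹) (s : ι → ι → ℂ)
    (x : ι → K) : ‖fieldIntegrand s (fun i => ϖ * x i)‖ₑ =
      ENNReal.ofReal ((residueCard K : ℝ) ^ (-(pairSum Finset.univ s).re)) *
        ‖fieldIntegrand s x‖ₑ := by
  have hq1 : (0 : ℝ) < residueCard K := by
    exact_mod_cast zero_lt_one.trans (one_lt_residueCard K)
  have h0 : ϖ ≠ 0 := norm_pos_iff.1 (by rw [hq]; positivity)
  rw [fieldIntegrand_mul s x h0, enorm_mul, ← ofReal_norm (_ ^ _),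
    Complex.norm_cpow_eq_rpow_re_of_pos (norm_pos_iff.2 h0), hq, Real.rpow_neg hq1.le,
    Real.inv_rpow hq1.le]

theorem shellRatio_lt_one_iff (s : ι → ι → ℂ) :
    shellRatio K s < 1 ↔ 0 < (Fintype.card ι : ℝ) - 1 + (pairSum Finset.univ s).re := by
  have hq : (1 : ℝ) < residueCard K := by exact_mod_cast one_lt_residueCard K
  rw [shellRatio, ENNReal.ofReal_lt_one, Real.rpow_lt_one_iff_of_pos (by linarith)]
  constructor
  · rintro (h | h)
    · linarith [h.2]
    · linarith [h.1]
  · intro h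
    exact Or.inl ⟨hq, by linarith⟩

end Shell

/-! ### Convergence over `P ^ ι` -/

section Convergence

theorem card_fiber_lt {ι κ : Type*} [Fintype ι] [DecidableEq κ] {f : ι → κ} {i j : ι} (hij : f i ≠ f j) (k : κ) :
    (fiber f k).card < Fintype.card ι := by
  refine Finset.card_lt_univ_of_notMem (x := if f i = k then j else i) ?_
  rw [mem_fiber]
  split_ifs with h
  · exact fun h' => hij (h.trans h'.symm)
  · exact h

variable (K : Type*) [NontriviallyNormedField K] [LocallyCompactSpace K] [MeasurableSpace K]
  [BorelSpace K]

/-- The integral of the absolute value of the integrand over `P ^ ι`. -/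
def absIntegralP {ι : Type*} [Fintype ι] [LinearOrder ι] (s : ι → ι → ℂ) : ℝ≥0∞ :=
  ∫⁻ x, ‖fieldIntegrand s x‖ₑ ∂haarPowP K ι

/-- The integral of the absolute value of the integrand over `R ^ ι`. -/
def absIntegralR {ι : Type*} [Fintype ι] [LinearOrder ι] (s : ι → ι → ℂ) : ℝ≥0∞ :=
  ∫⁻ x, ‖fieldIntegrand s x‖ₑ ∂haarPowR K ι

variable {K} {ι : Type*} [Fintype ι]

theorem measurable_enorm_fieldIntegrand [LinearOrder ι] (s : ι → ι → ℂ) :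
    Measurable fun x : ι → K => ‖fieldIntegrand s x‖ₑ := (measurable_fieldIntegrand s).enorm

theorem measurableSet_shell [IsUltrametricDist K] (ϖ : K) (n : ℕ) :
    MeasurableSet (shell ϖ n : Set (ι → K)) :=
  (measurableSet_lt measurable_const measurable_spread).inter
    (measurableSet_le measurable_spread measurable_const)

variable [IsUltrametricDist K] [LinearOrder ι]

theorem absIntegralP_eq {ϖ : K} (hq : ‖ϖ‖ = (residueCard K : ℝ)⁻¹)
    (hϖ : ∀ x : K, ‖x‖ < 1 ↔ ‖x‖ ≤ ‖ϖ‖) (s : ι → ι → ℂ) :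
    absIntegralP K s = ((residueCard K : ℝ≥0∞)⁻¹) ^ Fintype.card ι *
      (ENNReal.ofReal ((residueCard K : ℝ) ^ (-(pairSum Finset.univ s).re)) *
        absIntegralR K s) := by
  have hq1 : (0 : ℝ) < residueCard K := by
    exact_mod_cast zero_lt_one.trans (one_lt_residueCard K)
  have h0 : ϖ ≠ 0 := norm_pos_iff.1 (by rw [hq]; positivity)
  rw [absIntegralP, lintegral_haarPowP h0 hϖ (measurable_enorm_fieldIntegrand s)]
  simp_rw [enorm_fieldIntegrand_mul hq]
  rw [lintegral_const_mul _ (measurable_enorm_fieldIntegrand s), absIntegralR]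

theorem absIntegralR_ne_top_iff {ϖ : K} (hq : ‖ϖ‖ = (residueCard K : ℝ)⁻¹)
    (hϖ : ∀ x : K, ‖x‖ < 1 ↔ ‖x‖ ≤ ‖ϖ‖) (s : ι → ι → ℂ) :
    absIntegralR K s ≠ ⊤ ↔ absIntegralP K s ≠ ⊤ := by
  have hq1 : (0 : ℝ) < residueCard K := by
    exact_mod_cast zero_lt_one.trans (one_lt_residueCard K)
  have hc : (residueCard K : ℝ≥0∞)⁻¹ ^ Fintype.card ι ≠ ⊤ :=
    ENNReal.pow_ne_top (by simpa using (by exact_mod_cast hq1.ne' : residueCard K ≠ 0))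
  have hc0 : (residueCard K : ℝ≥0∞)⁻¹ ^ Fintype.card ι ≠ 0 := by simp
  have hd0 : ENNReal.ofReal ((residueCard K : ℝ) ^ (-(pairSum Finset.univ s).re)) ≠ 0 := by
    simpa using Real.rpow_pos_of_pos hq1 _
  rw [absIntegralP_eq hq hϖ]
  refine ⟨fun h => ENNReal.mul_ne_top hc (ENNReal.mul_ne_top ENNReal.ofReal_ne_top h),
    fun h h' => h ?_⟩
  rw [h', ENNReal.mul_top hd0, ENNReal.mul_top hc0]

theorem lintegral_shell_succ [Nonempty ι] {ϖ : K} (hq : ‖ϖ‖ = (residueCard K : ℝ)⁻¹)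
    (hϖ : ∀ x : K, ‖x‖ < 1 ↔ ‖x‖ ≤ ‖ϖ‖) (s : ι → ι → ℂ) (n : ℕ) :
    ∫⁻ x in shell ϖ (n + 1), ‖fieldIntegrand s x‖ₑ ∂haarPowR K ι =
      shellRatio K s * ∫⁻ x in shell ϖ n, ‖fieldIntegrand s x‖ₑ ∂haarPowR K ι := by
  have hq1 : (0 : ℝ) < residueCard K := by
    exact_mod_cast zero_lt_one.trans (one_lt_residueCard K)
  have hpos : 0 < ‖ϖ‖ := by rw [hq]; positivity
  have h0 : ϖ ≠ 0 := norm_pos_iff.1 hpos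
  have h1 : ‖ϖ‖ < 1 := (hϖ ϖ).2 le_rfl
  have hm := measurable_enorm_fieldIntegrand (K := K) s
  rw [← lintegral_indicator (measurableSet_shell ϖ _),
    ← lintegral_indicator (measurableSet_shell ϖ _),
    lintegral_haarPowR_rescale h0 hϖ (hm.indicator (measurableSet_shell ϖ _))]
  · have key : ∀ x : ι → K, (shell ϖ (n + 1)).indicator (fun x => ‖fieldIntegrand s x‖ₑ)
        (fun i => ϖ * x i) =
        ENNReal.ofReal ((residueCard K : ℝ) ^ (-(pairSum Finset.univ s).re)) *
          (shell ϖ n).indicator (fun x => ‖fieldIntegrand s x‖ₑ) x := by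
      intro x
      have hmem : (fun i => ϖ * x i) ∈ (shell ϖ (n + 1) : Set (ι → K)) ↔ x ∈ shell ϖ n := by
        simp only [shell, Set.mem_ofPred_eq, spread_mul, pow_succ' _ (n + 1), pow_succ' _ n,
          mul_lt_mul_iff_right₀ hpos, mul_le_mul_iff_right₀ hpos]
      by_cases hx : x ∈ shell ϖ n
      · rw [Set.indicator_of_mem hx, Set.indicator_of_mem (hmem.2 hx),
          enorm_fieldIntegrand_mul hq]
      · rw [Set.indicator_of_notMem hx, Set.indicator_of_notMem (mt hmem.1 hx), mul_zero]
    simp_rw [key]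
    rw [lintegral_const_mul _ (hm.indicator (measurableSet_shell ϖ _)), ← mul_assoc]
    congr 1
    rw [shellRatio, show -((Fintype.card ι : ℝ) - 1 + (pairSum Finset.univ s).re) =
      1 + -(Fintype.card ι : ℝ) + -(pairSum Finset.univ s).re by ring, Real.rpow_add hq1,
      Real.rpow_add hq1, Real.rpow_one, Real.rpow_neg hq1.le (Fintype.card ι : ℝ),
      Real.rpow_natCast,
      ENNReal.ofReal_mul (by positivity), ENNReal.ofReal_mul hq1.le, ENNReal.ofReal_natCast,
      ENNReal.ofReal_inv_of_pos (by positivity), ENNReal.ofReal_pow hq1.le,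
      ENNReal.ofReal_natCast, ENNReal.inv_pow]
  · intro x c
    have : (fun i => c + x i) ∈ (shell ϖ (n + 1) : Set (ι → K)) ↔ x ∈ shell ϖ (n + 1) := by
      simp only [shell, Set.mem_ofPred_eq, spread_add]
    by_cases hx : x ∈ shell ϖ (n + 1)
    · rw [Set.indicator_of_mem hx, Set.indicator_of_mem (this.2 hx), fieldIntegrand_add]
    · rw [Set.indicator_of_notMem hx, Set.indicator_of_notMem (mt this.1 hx)]
  · intro x hx
    refine Set.indicator_of_notMem (fun hx' => ?_) _
    have := pow_lt_one₀ (norm_nonneg ϖ) h1 (Nat.succ_ne_zero n)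
    exact absurd (hx.trans hx'.2) (not_le.2 this)

theorem lintegral_shell [Nonempty ι] {ϖ : K} (hq : ‖ϖ‖ = (residueCard K : ℝ)⁻¹)
    (hϖ : ∀ x : K, ‖x‖ < 1 ↔ ‖x‖ ≤ ‖ϖ‖) (s : ι → ι → ℂ) (n : ℕ) :
    ∫⁻ x in shell ϖ n, ‖fieldIntegrand s x‖ₑ ∂haarPowR K ι =
      shellRatio K s ^ n * ∫⁻ x in shell ϖ 0, ‖fieldIntegrand s x‖ₑ ∂haarPowR K ι := by
  induction n with
  | zero => simp
  | succ n ih => rw [lintegral_shell_succ hq hϖ, ih, pow_succ', mul_assoc]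

theorem absIntegralR_eq_tsum (hι : 1 < Fintype.card ι) {ϖ : K}
    (hq : ‖ϖ‖ = (residueCard K : ℝ)⁻¹) (hϖ : ∀ x : K, ‖x‖ < 1 ↔ ‖x‖ ≤ ‖ϖ‖) (s : ι → ι → ℂ) :
    absIntegralR K s = ∑' n : ℕ, shellRatio K s ^ n *
      ∫⁻ x in shell ϖ 0, ‖fieldIntegrand s x‖ₑ ∂haarPowR K ι := by
  have : Nonempty ι := Fintype.card_pos_iff.1 (by omega)
  have hq1 : (0 : ℝ) < residueCard K := by
    exact_mod_cast zero_lt_one.trans (one_lt_residueCard K)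
  have h0 : ϖ ≠ 0 := norm_pos_iff.1 (by rw [hq]; positivity)
  have h1 : ‖ϖ‖ < 1 := (hϖ ϖ).2 le_rfl
  simp_rw [← lintegral_shell hq hϖ s]
  rw [← lintegral_iUnion (fun n => measurableSet_shell ϖ n) (disjoint_shell h1), absIntegralR,
    Measure.restrict_eq_self_of_ae_mem]
  have hae : ∀ᵐ x ∂haarPowR K ι, spread x ≠ 0 := by
    rw [ae_iff]
    simpa using haarPowR_spread_eq_zero hι h0 hϖ
  filter_upwards [hae, ae_norm_le_one_haarPowR K ι] with x hx hx'
  exact Set.mem_iUnion.2 (exists_mem_shell h0 h1 (spread_le_one hx') hx)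

theorem lintegral_shell_zero_ne_zero (hι : 1 < Fintype.card ι) {ϖ : K} (h1 : ‖ϖ‖ < 1)
    (s : ι → ι → ℂ) : ∫⁻ x in shell ϖ 0, ‖fieldIntegrand s x‖ₑ ∂haarPowR K ι ≠ 0 := by
  have : ProperSpace K := ProperSpace.of_locallyCompactSpace K
  obtain ⟨i₀, i₁, hi⟩ := Fintype.one_lt_card_iff.1 hι
  let U : Set (ι → K) := {x | (∀ i, ‖x i - if i = i₀ then 1 else 0‖ < 1) ∧
    ∀ i j, i ≠ j → x i ≠ x j}
  have hU : IsOpen U := by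
    have hU' : U = (⋂ i, {x | ‖x i - if i = i₀ then 1 else 0‖ < 1}) ∩
        ⋂ i, ⋂ j, ⋂ _ : i ≠ j, {x | x i ≠ x j} := by
      ext
      simp [U]
    rw [hU']
    refine IsOpen.inter (isOpen_iInter_of_finite fun i => ?_)
      (isOpen_iInter_of_finite fun i => isOpen_iInter_of_finite fun j =>
        isOpen_iInter_of_finite fun _ => ?_)
    · exact isOpen_lt (by fun_prop) continuous_const
    · exact isOpen_ne_fun (continuous_apply i) (continuous_apply j)
  have hlt : ∀ x ∈ U, ∀ i, i ≠ i₀ → ‖x i‖ < 1 := fun x hx i hi => by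
    simpa [hi] using hx.1 i
  have heq : ∀ x ∈ U, ‖x i₀‖ = 1 := fun x hx => by
    have h := hx.1 i₀
    rw [if_pos rfl] at h
    have h' := IsUltrametricDist.norm_add_eq_max_of_norm_ne_norm (x := x i₀ - 1) (y := 1)
      (by rw [norm_one]; exact h.ne)
    rwa [sub_add_cancel, norm_one, max_eq_right h.le] at h'
  have hle : ∀ x ∈ U, ∀ i, ‖x i‖ ≤ 1 := fun x hx i => by
    by_cases hi : i = i₀
    · rw [hi, heq x hx]
    · exact (hlt x hx i hi).le
  have hne : U.Nonempty := by
    have hinf : (ball (0 : K) 1).Infinite := infinite_of_mem_nhds 0 (ball_mem_nhds _ one_pos)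
    have := hinf.to_subtype
    let y : ι ↪ ball (0 : K) 1 := (Fintype.equivFin ι).toEmbedding.trans
      (Fin.valEmbedding.trans (Infinite.natEmbedding _))
    have hy : ∀ i, ‖(y i : K)‖ < 1 := fun i => mem_ball_zero_iff.1 (y i).2
    have hy' : ‖(y i₀ : K) + 1‖ = 1 := by
      rw [IsUltrametricDist.norm_add_eq_max_of_norm_ne_norm (by rw [norm_one]; exact (hy _).ne),
        norm_one, max_eq_right (hy _).le]
    refine ⟨fun i => y i + if i = i₀ then 1 else 0, fun i => by simpa using hy i, ?_⟩
    intro i j hij h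
    by_cases hii : i = i₀
    · have hjj : j ≠ i₀ := fun h => hij (hii.trans h.symm)
      simp only [hii, if_true, if_neg hjj, add_zero] at h
      rw [h] at hy'
      exact (hy j).ne hy'
    · by_cases hjj : j = i₀
      · simp only [if_neg hii, hjj, if_true, add_zero] at h
        rw [← h] at hy'
        exact (hy i).ne hy'
      · simp only [if_neg hii, if_neg hjj, add_zero] at h
        exact hij (y.injective (Subtype.ext h))
  have hsub : U ⊆ shell ϖ 0 := fun x hx => by
    refine ⟨?_, by simpa using spread_le_one (hle x hx)⟩
    rw [zero_add, pow_one]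
    have h' := hlt x hx i₁ hi.symm
    have h : ‖x i₀ - x i₁‖ = 1 := by
      rw [sub_eq_add_neg, IsUltrametricDist.norm_add_eq_max_of_norm_ne_norm
        (by rw [norm_neg, heq x hx]; exact h'.ne'), norm_neg, heq x hx, max_eq_left h'.le]
    calc ‖ϖ‖ < 1 := h1
      _ = ‖x i₀ - x i₁‖ := h.symm
      _ ≤ spread x := norm_sub_le_spread x i₀ i₁
  intro hzero
  rw [lintegral_eq_zero_iff (measurable_enorm_fieldIntegrand s), Filter.eventuallyEq_iff_exists_mem]
    at hzero
  obtain ⟨t, ht, htz⟩ := hzero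
  have hdisj : U ⊆ tᶜ := fun x hx hxt => by
    have := htz hxt
    simp only [Pi.zero_apply, enorm_eq_zero] at this
    exact fieldIntegrand_ne_zero s (fun i j h => by_contra fun hij => hx.2 i j hij h) this
  have h2 : haarPowR K ι U = 0 := by
    have h3 := measure_mono_null hdisj (mem_ae_iff.1 ht)
    rwa [Measure.restrict_apply hU.measurableSet, Set.inter_eq_left.2 hsub] at h3
  rw [haarPowR_eq_restrict, Measure.restrict_apply hU.measurableSet, Set.inter_eq_left.2
    fun x hx => Set.mem_univ_pi.2 fun i => by simpa using hle x hx i] at h2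
  exact (hU.measure_pos _ hne).ne' h2

theorem exponent_pos_of_absIntegralP_ne_top (hK : IsCanonicalNorm K) (hι : 1 < Fintype.card ι)
    {s : ι → ι → ℂ} (h : absIntegralP K s ≠ ⊤) :
    0 < (Fintype.card ι : ℝ) - 1 + (pairSum Finset.univ s).re := by
  obtain ⟨ϖ, hq, hϖ⟩ := exists_uniformizer hK
  rw [← shellRatio_lt_one_iff (K := K)]
  by_contra! hge
  rw [← absIntegralR_ne_top_iff hq hϖ, absIntegralR_eq_tsum hι hq hϖ, ENNReal.tsum_mul_right] at h
  have h0 := lintegral_shell_zero_ne_zero hι ((hϖ ϖ).2 le_rfl) s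
  have htop : ∑' n : ℕ, shellRatio K s ^ n = ⊤ := by
    refine top_le_iff.1 ?_
    rw [← ENNReal.tsum_const_eq_top_of_ne_zero (α := ℕ) one_ne_zero]
    exact ENNReal.tsum_le_tsum fun n => one_le_pow₀ hge
  rw [htop, ENNReal.top_mul h0] at h
  exact h rfl

/-- Shifting every coordinate by a residue class factors the integral over the classes. -/
theorem lintegral_shift_eq_prod {n : ℕ} {r : Fin n → K} (hr : ∀ k, ‖r k‖ ≤ 1)
    (hr' : ∀ x : K, ‖x‖ ≤ 1 → ∃! k, ‖x - r k‖ < 1) (f : ι → Fin n) (s : ι → ι → ℂ) :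
    ∫⁻ x, ‖fieldIntegrand s (fun i => r (f i) + x i)‖ₑ ∂haarPowP K ι =
      ∏ k, absIntegralP K (fun i j : fiber f k => s i j) := by
  simp only [absIntegralP, haarPowP]
  rw [← lintegral_prod_fibers f (haarP K)
    (fun k y => ‖fieldIntegrand (fun i j : fiber f k => s i j) y‖ₑ)
    fun k => measurable_enorm_fieldIntegrand _]
  refine lintegral_congr_ae ?_
  filter_upwards [ae_norm_lt_one_haarPowP K ι] with x hx
  rw [fieldIntegrand, gasIntegrand_eq_prod_fibers _ (fun a b : K => ‖a - b‖) s f _ x]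
  · simp only [← ofReal_norm, norm_prod]
    rw [ENNReal.ofReal_prod_of_nonneg fun _ _ => norm_nonneg _]
    rfl
  · intro i j hij
    simp [hij]
  · intro i j hij
    exact norm_add_sub_add_of_ne hr hr' hij (hx i) (hx j)

theorem lintegral_shell_zero_ne_top [Nonempty ι] {ϖ : K} (hϖ : ∀ x : K, ‖x‖ < 1 ↔ ‖x‖ ≤ ‖ϖ‖)
    (s : ι → ι → ℂ)
    (h : ∀ J : Finset ι, J.card < Fintype.card ι → absIntegralP K (fun i j : J => s i j) ≠ ⊤) :
    ∫⁻ x in shell ϖ 0, ‖fieldIntegrand s x‖ₑ ∂haarPowR K ι ≠ ⊤ := by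
  obtain ⟨r, hr, hr'⟩ := exists_representatives K
  have hm := measurable_enorm_fieldIntegrand (K := K) s
  rw [← lintegral_indicator (measurableSet_shell ϖ _),
    lintegral_haarPowR hr hr' (hm.indicator (measurableSet_shell ϖ _))]
  refine ENNReal.sum_ne_top.2 fun f _ => ?_
  by_cases hf : ∃ i j, f i ≠ f j
  · obtain ⟨i, j, hij⟩ := hf
    refine ne_top_of_le_ne_top ?_ (lintegral_mono fun x => Set.indicator_le_self _ _ _)
    rw [lintegral_shift_eq_prod hr hr']
    refine ENNReal.prod_ne_top fun k _ => h _ ?_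
    exact card_fiber_lt hij k
  · push Not at hf
    rw [lintegral_congr_ae (g := 0)]
    · simp
    filter_upwards [ae_norm_lt_one_haarPowP K ι] with x hx
    refine Set.indicator_of_notMem (fun hx' => not_le.2 hx'.1 ?_) _
    rw [zero_add, pow_one, spread_le_iff (norm_nonneg _)]
    intro i j
    rw [← hϖ, hf i j, add_sub_add_left_eq_sub]
    exact (norm_sub_le_max_norm _ _).trans_lt (max_lt (hx i) (hx j))

theorem absIntegralP_ne_top (hK : IsCanonicalNorm K) (s : ι → ι → ℂ)
    (h : ∀ J : Finset ι, 1 < J.card → 0 < (J.card : ℝ) - 1 + (pairSum J s).re) :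
    absIntegralP K s ≠ ⊤ := by
  obtain ⟨ϖ, hq, hϖ⟩ := exists_uniformizer hK
  induction hn : Fintype.card ι using Nat.strong_induction_on generalizing ι with
  | h n ih =>
  rcases Nat.lt_or_ge 1 n with hι | hι
  · subst hn
    have : Nonempty ι := Fintype.card_pos_iff.1 (by omega)
    rw [← absIntegralR_ne_top_iff hq hϖ, absIntegralR_eq_tsum hι hq hϖ, ENNReal.tsum_mul_right,
      ENNReal.tsum_geometric]
    have hlt : shellRatio K s < 1 := (shellRatio_lt_one_iff s).2 (h Finset.univ hι)
    refine ENNReal.mul_ne_top (ENNReal.inv_ne_top.2 (tsub_pos_of_lt hlt).ne')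
      (lintegral_shell_zero_ne_top hϖ s fun J hJ => ?_)
    refine ih J.card hJ _ (fun J' hJ' => ?_) (Fintype.card_coe J)
    rw [pairSum_coe, ← Finset.card_map (Function.Embedding.subtype _)]
    exact h _ (by rwa [Finset.card_map])
  · subst hn
    simp only [absIntegralP, fieldIntegrand, gasIntegrand_of_card_le_one hι]
    simp

end Convergence

/-! ### Charts of the projective line -/

section Charts

variable {K : Type*} [NontriviallyNormedField K]

/-- The chart `x ↦ [x : 1]`. -/
def affineChart (x : K) : ProjLine K :=
  Projectivization.mk K ![x, 1] fun h => one_ne_zero (congrFun h 1)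

/-- The chart `x ↦ [1 : x]`. -/
def poleChart (x : K) : ProjLine K :=
  Projectivization.mk K ![1, x] fun h => one_ne_zero (congrFun h 0)

theorem affineChart_mul {c : K} (hc : c ≠ 0) (x : K) :
    Projectivization.mk K ![c * x, c] (fun h => hc (congrFun h 1)) = affineChart x :=
  (Projectivization.mk_eq_mk_iff' K _ _ _ _).2 ⟨c, by ext i; fin_cases i <;> simp⟩

theorem poleChart_mul {c : K} (hc : c ≠ 0) (x : K) :
    Projectivization.mk K ![c, c * x] (fun h => hc (congrFun h 0)) = poleChart x :=
  (Projectivization.mk_eq_mk_iff' K _ _ _ _).2 ⟨c, by ext i; fin_cases i <;> simp⟩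

theorem mem_cone_iff {M : Set (ProjLine K)} {v : Fin 2 → K} (hv : v ≠ 0) :
    v ∈ Subtype.val '' (Projectivization.mk' K (V := Fin 2 → K) ⁻¹' M) ↔
      Projectivization.mk K v hv ∈ M :=
  ⟨fun ⟨w, hw, h⟩ => by subst h; exact hw, fun h => ⟨⟨v, hv⟩, h, rfl⟩⟩

theorem continuous_affineChart : Continuous (affineChart : K → ProjLine K) := by
  have h : Continuous fun x : K => (⟨![x, 1], fun h => one_ne_zero (congrFun h 1)⟩ :
      {v : Fin 2 → K // v ≠ 0}) := by
    refine Continuous.subtype_mk (continuous_pi fun i => ?_) _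
    fin_cases i
    exacts [continuous_id, continuous_const]
  exact isOpenQuotientMap_mk.continuous.comp h

theorem continuous_poleChart : Continuous (poleChart : K → ProjLine K) := by
  have h : Continuous fun x : K => (⟨![1, x], fun h => one_ne_zero (congrFun h 0)⟩ :
      {v : Fin 2 → K // v ≠ 0}) := by
    refine Continuous.subtype_mk (continuous_pi fun i => ?_) _
    fin_cases i
    exacts [continuous_const, continuous_id]
  exact isOpenQuotientMap_mk.continuous.comp h

theorem sphericalDist_affineChart {x y : K} (hx : ‖x‖ ≤ 1) (hy : ‖y‖ ≤ 1) :
    sphericalDist (affineChart x) (affineChart y) = ‖x - y‖ := by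
  rw [affineChart, affineChart, sphericalDist_mk]
  simp [hx, hy]

theorem sphericalDist_poleChart {x y : K} (hx : ‖x‖ ≤ 1) (hy : ‖y‖ ≤ 1) :
    sphericalDist (poleChart x) (poleChart y) = ‖x - y‖ := by
  rw [poleChart, poleChart, sphericalDist_mk]
  simp [hx, hy, norm_sub_rev]

theorem sphericalDist_comm (p r : ProjLine K) : sphericalDist p r = sphericalDist r p := by
  rw [sphericalDist, sphericalDist, mul_comm (max _ _), norm_sub_rev, mul_comm (p.rep 1),
    mul_comm (p.rep 0)]

theorem sphericalDist_poleChart_affineChart [IsUltrametricDist K] {x y : K} (hx : ‖x‖ < 1)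
    (hy : ‖y‖ ≤ 1) : sphericalDist (poleChart x) (affineChart y) = 1 := by
  have h : ‖-(x * y)‖ < 1 := by
    rw [norm_neg, norm_mul]
    exact mul_lt_one_of_nonneg_of_lt_one_left (norm_nonneg _) hx hy
  have h' : ‖1 - x * y‖ = 1 := by
    rw [sub_eq_add_neg, IsUltrametricDist.norm_add_eq_max_of_norm_ne_norm
      (by rw [norm_one]; exact h.ne'), norm_one, max_eq_left h.le]
  rw [poleChart, affineChart, sphericalDist_mk]
  simp [hx.le, hy, h']

theorem continuous_sphericalDist :
    Continuous fun z : ProjLine K × ProjLine K => sphericalDist z.1 z.2 := by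
  rw [← (isOpenQuotientMap_mk.prodMap isOpenQuotientMap_mk).continuous_comp_iff]
  have h : ∀ v : {v : Fin 2 → K // v ≠ 0}, max ‖v.1 0‖ ‖v.1 1‖ ≠ 0 := fun v hv => by
    refine v.2 (funext fun i => ?_)
    have h0 : ‖v.1 0‖ ≤ 0 := hv ▸ le_max_left _ _
    have h1 : ‖v.1 1‖ ≤ 0 := hv ▸ le_max_right _ _
    fin_cases i
    exacts [norm_le_zero_iff.1 h0, norm_le_zero_iff.1 h1]
  have heq : ((fun z : ProjLine K × ProjLine K => sphericalDist z.1 z.2) ∘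
      Prod.map (Projectivization.mk' K) (Projectivization.mk' K)) =
      fun w : {v : Fin 2 → K // v ≠ 0} × {v : Fin 2 → K // v ≠ 0} =>
        ‖w.1.1 0 * w.2.1 1 - w.1.1 1 * w.2.1 0‖ /
          (max ‖w.1.1 0‖ ‖w.1.1 1‖ * max ‖w.2.1 0‖ ‖w.2.1 1‖) := by
    ext w
    exact sphericalDist_mk _ _ w.1.2 w.2.2
  rw [heq]
  have h₁ : ∀ i, Continuous fun w : {v : Fin 2 → K // v ≠ 0} × {v : Fin 2 → K // v ≠ 0} =>
      w.1.1 i := fun i => (continuous_apply i).comp (continuous_subtype_val.comp continuous_fst)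
  have h₂ : ∀ i, Continuous fun w : {v : Fin 2 → K // v ≠ 0} × {v : Fin 2 → K // v ≠ 0} =>
      w.2.1 i := fun i => (continuous_apply i).comp (continuous_subtype_val.comp continuous_snd)
  exact Continuous.div (((h₁ 0).mul (h₂ 1)).sub ((h₁ 1).mul (h₂ 0))).norm
    (((h₁ 0).norm.max (h₁ 1).norm).mul ((h₂ 0).norm.max (h₂ 1).norm))
    fun w => mul_ne_zero (h _) (h _)

/-- The `q + 1` charts covering the projective line: the residue disc of `[1 : 0]` and the residue
discs of the points `[r k : 1]`. -/
def discChart {n : ℕ} (r : Fin n → K) (k : Fin (n + 1)) (x : K) : ProjLine K :=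
  Fin.cases (poleChart x) (fun k => affineChart (r k + x)) k

theorem continuous_discChart {n : ℕ} (r : Fin n → K) (k : Fin (n + 1)) :
    Continuous (discChart r k) := by
  cases k using Fin.cases with
  | zero => exact continuous_poleChart
  | succ k => exact continuous_affineChart.comp (continuous_const_add (r k))

variable [IsUltrametricDist K]

theorem norm_add_le_one {x y : K} (hx : ‖x‖ ≤ 1) (hy : ‖y‖ ≤ 1) : ‖x + y‖ ≤ 1 :=
  (IsUltrametricDist.norm_add_le_max _ _).trans (max_le hx hy)

theorem sphericalDist_discChart {n : ℕ} {r : Fin n → K} (hr : ∀ k, ‖r k‖ ≤ 1) (k : Fin (n + 1))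
    {x y : K} (hx : ‖x‖ < 1) (hy : ‖y‖ < 1) :
    sphericalDist (discChart r k x) (discChart r k y) = ‖x - y‖ := by
  cases k using Fin.cases with
  | zero => exact sphericalDist_poleChart hx.le hy.le
  | succ k =>
    refine (sphericalDist_affineChart (norm_add_le_one (hr k) hx.le)
      (norm_add_le_one (hr k) hy.le)).trans ?_
    rw [add_sub_add_left_eq_sub]

theorem sphericalDist_discChart_of_ne [LocallyCompactSpace K] {n : ℕ} {r : Fin n → K}
    (hr : ∀ k, ‖r k‖ ≤ 1) (hr' : ∀ x : K, ‖x‖ ≤ 1 → ∃! k, ‖x - r k‖ < 1) {k l : Fin (n + 1)}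
    (hkl : k ≠ l) {x y : K} (hx : ‖x‖ < 1) (hy : ‖y‖ < 1) :
    sphericalDist (discChart r k x) (discChart r l y) = 1 := by
  cases k using Fin.cases with
  | zero =>
    cases l using Fin.cases with
    | zero => exact absurd rfl hkl
    | succ l => exact sphericalDist_poleChart_affineChart hx (norm_add_le_one (hr l) hy.le)
  | succ k =>
    cases l using Fin.cases with
    | zero =>
      rw [sphericalDist_comm]
      exact sphericalDist_poleChart_affineChart hy (norm_add_le_one (hr k) hx.le)
    | succ l =>
      refine (sphericalDist_affineChart (norm_add_le_one (hr k) hx.le)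
        (norm_add_le_one (hr l) hy.le)).trans ?_
      exact norm_add_sub_add_of_ne hr hr' (fun h => hkl (congrArg _ h)) hx hy

end Charts

/-! ### The invariant measure in charts -/

section DiscMass

variable (K : Type*) [NontriviallyNormedField K] [IsUltrametricDist K]

/-- The mass `q / (q + 1)` by which Haar measure on a residue disc has to be scaled. -/
def discMass : ℝ≥0∞ := (1 + (residueCard K : ℝ≥0∞)⁻¹)⁻¹

theorem discMass_ne_top : discMass K ≠ ⊤ := by simp [discMass]

variable [LocallyCompactSpace K]

theorem discMass_ne_zero : discMass K ≠ 0 := by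
  have := one_lt_residueCard K
  simp [discMass]
  omega

theorem toReal_discMass :
    (discMass K).toReal = (residueCard K : ℝ) / ((residueCard K : ℝ) + 1) := by
  have h : (0 : ℝ) < residueCard K := by exact_mod_cast zero_lt_one.trans (one_lt_residueCard K)
  have h' : (residueCard K : ℝ≥0∞)⁻¹ ≠ ⊤ := by
    have := one_lt_residueCard K
    simp
    omega
  rw [discMass, ENNReal.toReal_inv, ENNReal.toReal_add ENNReal.one_ne_top h', ENNReal.toReal_inv,
    ENNReal.toReal_one, ENNReal.toReal_natCast]
  field_simp

end DiscMass

section ProjMeasure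

variable {K : Type*} [NontriviallyNormedField K] [LocallyCompactSpace K] [MeasurableSpace K]
  [BorelSpace K]

theorem measurableSet_cone {M : Set (ProjLine K)} (hM : MeasurableSet M) :
    MeasurableSet (Subtype.val '' (Projectivization.mk' K (V := Fin 2 → K) ⁻¹' M)) := by
  have : ProperSpace K := ProperSpace.of_locallyCompactSpace K
  exact MeasurableSet.subtype_image (measurableSet_singleton (0 : Fin 2 → K)).compl
    (isOpenQuotientMap_mk.continuous.measurable hM)

theorem planeHaar_apply {S : Set (Fin 2 → K)} (hS : MeasurableSet S) :
    planeHaar K S = ((haar K).prod (haar K)) {z | ![z.1, z.2] ∈ S} := by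
  have h := (measurePreserving_piFinTwo fun _ : Fin 2 => haar K).symm
  rw [planeHaar, ← h.measure_preimage hS.nullMeasurableSet]
  congr 1

theorem planeHaar_primitive_inter {M : Set (ProjLine K)} (hM : MeasurableSet M) :
    planeHaar K (primitiveVectors K ∩ Subtype.val ''
      (Projectivization.mk' K (V := Fin 2 → K) ⁻¹' M)) =
      haar K (sphere 0 1) * (haarR K (affineChart ⁻¹' M) + haarP K (poleChart ⁻¹' M)) := by
  have : ProperSpace K := ProperSpace.of_locallyCompactSpace K
  have hC := measurableSet_cone hM
  set C : Set (Fin 2 → K) :=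
    Subtype.val '' (Projectivization.mk' K (V := Fin 2 → K) ⁻¹' M) with hCdef
  have hm : Measurable fun z : K × K => ![z.1, z.2] := by
    have : Continuous fun z : K × K => ![z.1, z.2] := by
      refine continuous_pi fun i => ?_
      fin_cases i
      exacts [continuous_fst, continuous_snd]
    exact this.measurable
  have hC' : MeasurableSet {z : K × K | ![z.1, z.2] ∈ C} := hm hC
  let S₁ : Set (K × K) := {z | ‖z.1‖ ≤ 1 ∧ ‖z.2‖ = 1 ∧ ![z.1, z.2] ∈ C}
  let S₂ : Set (K × K) := {z | ‖z.1‖ = 1 ∧ ‖z.2‖ < 1 ∧ ![z.1, z.2] ∈ C}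
  have hS₁ : MeasurableSet S₁ :=
    (measurableSet_le measurable_fst.norm measurable_const).inter
      ((measurableSet_eq_fun measurable_snd.norm measurable_const).inter hC')
  have hS₂ : MeasurableSet S₂ :=
    (measurableSet_eq_fun measurable_fst.norm measurable_const).inter
      ((measurableSet_lt measurable_snd.norm measurable_const).inter hC')
  have hsplit : {z : K × K | ![z.1, z.2] ∈ primitiveVectors K ∩ C} = S₁ ∪ S₂ := by
    ext z
    have hn : ‖(![z.1, z.2] : Fin 2 → K)‖ = max ‖z.1‖ ‖z.2‖ := by
      refine le_antisymm ((pi_norm_le_iff_of_nonneg (by positivity)).2 fun i => ?_)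
        (max_le (norm_le_pi_norm ![z.1, z.2] 0) (norm_le_pi_norm ![z.1, z.2] 1))
      fin_cases i
      exacts [le_max_left _ _, le_max_right _ _]
    simp only [Set.mem_ofPred_eq, Set.mem_inter_iff, primitiveVectors, mem_sphere_zero_iff_norm,
      hn, Set.mem_union, S₁, S₂]
    constructor
    · rintro ⟨h, hz⟩
      rcases (le_max_right ‖z.1‖ ‖z.2‖).trans_eq h |>.lt_or_eq with h2 | h2
      · rcases max_choice ‖z.1‖ ‖z.2‖ with h3 | h3
        · exact Or.inr ⟨h3 ▸ h, h2, hz⟩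
        · exact absurd (h3 ▸ h) h2.ne
      · exact Or.inl ⟨(le_max_left _ _).trans_eq h, h2, hz⟩
    · rintro (⟨h1, h2, hz⟩ | ⟨h1, h2, hz⟩)
      · exact ⟨by rw [h2, max_eq_right h1], hz⟩
      · exact ⟨by rw [h1, max_eq_left h2.le], hz⟩
  have hdisj : Disjoint S₁ S₂ := Set.disjoint_left.2 fun z h1 h2 => h2.2.1.ne h1.2.1
  have hsph : MeasurableSet (sphere (0 : K) 1) := isClosed_sphere.measurableSet
  have hne : ∀ y : K, ‖y‖ = 1 → y ≠ 0 := fun y hy => norm_ne_zero_iff.1 (by simp [hy])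
  have h₁ : ((haar K).prod (haar K)) S₁ =
      haar K (sphere 0 1) * haarR K (affineChart ⁻¹' M) := by
    rw [Measure.prod_apply_symm hS₁, mul_comm, ← lintegral_indicator_const hsph]
    refine lintegral_congr fun y => ?_
    by_cases hy : ‖y‖ = 1
    · rw [Set.indicator_of_mem (by simpa using hy)]
      have hyC : MeasurableSet {x : K | ![x, y] ∈ C} :=
        hC'.preimage (measurable_id.prodMk measurable_const)
      have : (fun x => (x, y)) ⁻¹' S₁ = {x | ![x, y] ∈ C} ∩ closedBall 0 1 := by
        ext x
        simp [S₁, hy, and_comm]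
      rw [this, ← Measure.restrict_apply hyC, ← haarR, ← haarR_map_unit hy,
        Measure.map_apply (continuous_const_mul y).measurable hyC, haarR_map_unit hy]
      congr 1
      ext x
      have hv : (![y * x, y] : Fin 2 → K) ≠ 0 := fun h => hne y hy (congrFun h 1)
      rw [Set.mem_preimage, Set.mem_preimage, Set.mem_ofPred_eq, hCdef, mem_cone_iff hv,
        affineChart_mul (hne y hy)]
    · rw [Set.indicator_of_notMem (by simpa using hy)]
      have : (fun x => (x, y)) ⁻¹' S₁ = ∅ := by
        ext x
        simp [S₁, hy]
      rw [this, measure_empty]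
  have h₂ : ((haar K).prod (haar K)) S₂ =
      haar K (sphere 0 1) * haarP K (poleChart ⁻¹' M) := by
    rw [Measure.prod_apply hS₂, mul_comm, ← lintegral_indicator_const hsph]
    refine lintegral_congr fun y => ?_
    by_cases hy : ‖y‖ = 1
    · rw [Set.indicator_of_mem (by simpa using hy)]
      have hyC : MeasurableSet {x : K | ![y, x] ∈ C} :=
        hC'.preimage (measurable_const.prodMk measurable_id)
      have : Prod.mk y ⁻¹' S₂ = {x | ![y, x] ∈ C} ∩ {x | ‖x‖ < 1} := by
        ext x
        simp [S₂, hy, and_comm]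
      rw [this, ← Measure.restrict_apply hyC, ← haarP, ← haarP_map_unit hy,
        Measure.map_apply (continuous_const_mul y).measurable hyC, haarP_map_unit hy]
      congr 1
      ext x
      have hv : (![y, y * x] : Fin 2 → K) ≠ 0 := fun h => hne y hy (congrFun h 0)
      rw [Set.mem_preimage, Set.mem_preimage, Set.mem_ofPred_eq, hCdef, mem_cone_iff hv,
        poleChart_mul (hne y hy)]
    · rw [Set.indicator_of_notMem (by simpa using hy)]
      have : Prod.mk y ⁻¹' S₂ = ∅ := by
        ext x
        simp [S₂, hy]
      rw [this, measure_empty]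
  rw [planeHaar_apply ((show MeasurableSet (primitiveVectors K) from
    isClosed_sphere.measurableSet).inter hC), hsplit, measure_union hdisj hS₂, h₁, h₂, mul_add]

variable [IsUltrametricDist K]

theorem projMeasure_eq :
    projMeasure K = discMass K • ((haarR K).map affineChart + (haarP K).map poleChart) := by
  have ha := (continuous_affineChart (K := K)).measurable
  have hp := (continuous_poleChart (K := K)).measurable
  have key : ∀ M : Set (ProjLine K), MeasurableSet M → projMeasure K M =
      (planeHaar K (primitiveVectors K))⁻¹ * haar K (sphere 0 1) *
        (haarR K (affineChart ⁻¹' M) + haarP K (poleChart ⁻¹' M)) := fun M hM => by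
    rw [projMeasure_apply hM, planeHaar_primitive_inter hM, mul_assoc]
  have h1 := key Set.univ MeasurableSet.univ
  rw [measure_univ, Set.preimage_univ, Set.preimage_univ, measure_univ, haarP_univ] at h1
  ext M hM
  rw [key M hM, discMass, ← ENNReal.eq_inv_of_mul_eq_one_left h1.symm]
  simp [Measure.map_apply ha hM, Measure.map_apply hp hM, mul_add]

theorem projMeasure_eq_sum {r : Fin (residueCard K) → K} (hr : ∀ k, ‖r k‖ ≤ 1)
    (hr' : ∀ x : K, ‖x‖ ≤ 1 → ∃! k, ‖x - r k‖ < 1) :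
    projMeasure K = discMass K • ∑ k, (haarP K).map (discChart r k) := by
  have ha := (continuous_affineChart (K := K)).measurable
  have hm : ∀ c : K, Measurable (c + · : K → K) := fun c => (continuous_const_add c).measurable
  rw [projMeasure_eq, Fin.sum_univ_succ, add_comm]
  congr 2
  ext M hM
  rw [Measure.map_apply ha hM, haarR_eq_sum hr hr']
  simp only [Measure.coe_finsetSum, Finset.sum_apply]
  refine Finset.sum_congr rfl fun k _ => ?_
  rw [Measure.map_apply (hm _) (ha hM), Measure.map_apply (continuous_discChart r _).measurable hM]
  rfl

end ProjMeasure

/-! ### The partition function of the projective line -/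

section Main

theorem measurable_projIntegrand {K : Type*} [NontriviallyNormedField K]
    [LocallyCompactSpace K] {N : ℕ} (s : Fin N → Fin N → ℂ) : Measurable (projIntegrand K s) := by
  have : ProperSpace K := ProperSpace.of_locallyCompactSpace K
  have : SecondCountableTopology (ProjLine K) :=
    isOpenQuotientMap_mk.isQuotientMap.secondCountableTopology isOpenQuotientMap_mk.isOpenMap
  refine Finset.measurable_fun_prod _ fun p _ => ?_
  refine Measurable.pow_const (Complex.measurable_ofReal.comp ?_) _
  have h : Measurable fun x : Fin N → ProjLine K => (x p.1, x p.2) :=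
    (measurable_pi_apply p.1).prodMk (measurable_pi_apply p.2)
  exact (continuous_sphericalDist (K := K)).measurable.comp h

variable {K : Type*} [NontriviallyNormedField K] [MeasurableSpace K] [BorelSpace K]

theorem measurable_discCharts {N n : ℕ} (r : Fin n → K) (f : Fin N → Fin (n + 1)) :
    Measurable fun (x : Fin N → K) i => discChart r (f i) (x i) :=
  measurable_pi_lambda _ fun i =>
    (continuous_discChart r (f i)).measurable.comp (measurable_pi_apply i)

variable [LocallyCompactSpace K]

theorem integrable_prod_fibers_iff {ι κ : Type*} [Fintype ι] [LinearOrder ι] [Fintype κ]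
    [DecidableEq κ] (f : ι → κ) (s : ι → ι → ℂ) :
    Integrable (fun x : ι → K => ∏ k, fieldIntegrand (fun i j : fiber f k => s i j)
      fun i : fiber f k => x i) (haarPowP K ι) ↔
      ∏ k, absIntegralP K (fun i j : fiber f k => s i j) ≠ ⊤ := by
  have hm : Measurable fun x : ι → K => ∏ k, fieldIntegrand (fun i j : fiber f k => s i j)
      fun i : fiber f k => x i :=
    Finset.measurable_fun_prod _ fun k _ => (measurable_fieldIntegrand _).comp
      (measurable_pi_lambda _ fun i => measurable_pi_apply _)
  have h := lintegral_prod_fibers f (haarP K)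
    (fun k y => ‖fieldIntegrand (fun i j : fiber f k => s i j) y‖ₑ)
    fun k => measurable_enorm_fieldIntegrand _
  simp only [absIntegralP, haarPowP]
  rw [← h, Integrable, and_iff_right hm.aestronglyMeasurable, HasFiniteIntegral, lt_top_iff_ne_top]
  simp only [← ofReal_norm, norm_prod, ENNReal.ofReal_prod_of_nonneg fun _ _ => norm_nonneg _]

theorem partitionFunction_eq_integral {N : ℕ} (s : Fin N → Fin N → ℂ) (I : Finset (Fin N)) :
    partitionFunction I {x : K | ‖x‖ < 1} s =
      ∫ x, fieldIntegrand (fun i j : I => s i j) x ∂haarPowP K I := by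
  rw [partitionFunction, haarPowP_eq_restrict]
  rfl

variable [IsUltrametricDist K]

theorem absIntegralP_ne_zero {ι : Type*} [Fintype ι] [LinearOrder ι] (hK : IsCanonicalNorm K)
    (s : ι → ι → ℂ) : absIntegralP K s ≠ 0 := by
  obtain ⟨ϖ, hq, hϖ⟩ := exists_uniformizer hK
  have hq1 : (0 : ℝ) < residueCard K := by
    exact_mod_cast zero_lt_one.trans (one_lt_residueCard K)
  rcases Nat.lt_or_ge 1 (Fintype.card ι) with hι | hι
  · rw [absIntegralP_eq hq hϖ]
    refine mul_ne_zero (by simp) (mul_ne_zero ?_ fun h => ?_)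
    · simpa using Real.rpow_pos_of_pos hq1 _
    · exact lintegral_shell_zero_ne_zero hι ((hϖ ϖ).2 le_rfl) s
        (le_antisymm ((setLIntegral_le_lintegral _ _).trans h.le) zero_le)
  · simp only [absIntegralP, fieldIntegrand, gasIntegrand_of_card_le_one hι, enorm_one,
      lintegral_const, one_mul, haarPowP, Measure.pi_univ, haarP_univ]
    simp

variable {N : ℕ} (s : Fin N → Fin N → ℂ)

variable {r : Fin (residueCard K) → K}

theorem projMeasurePow_eq (hr : ∀ k, ‖r k‖ ≤ 1)
    (hr' : ∀ x : K, ‖x‖ ≤ 1 → ∃! k, ‖x - r k‖ < 1) :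
    projMeasurePow K N = discMass K ^ N • ∑ f : Fin N → Fin (residueCard K + 1),
      (haarPowP K (Fin N)).map fun x i => discChart r (f i) (x i) := by
  rw [projMeasurePow, projMeasure_eq_sum hr hr', pi_const_smul _ (discMass_ne_top K),
    pi_sum_map _ fun k => (continuous_discChart r k).measurable, Fintype.card_fin]
  rfl

theorem projIntegrand_discCharts_ae (hr : ∀ k, ‖r k‖ ≤ 1)
    (hr' : ∀ x : K, ‖x‖ ≤ 1 → ∃! k, ‖x - r k‖ < 1) (f : Fin N → Fin (residueCard K + 1)) :
    (fun x : Fin N → K => projIntegrand K s fun i => discChart r (f i) (x i))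
      =ᵐ[haarPowP K (Fin N)] fun x => ∏ k, fieldIntegrand (fun i j : fiber f k => s i j)
        fun i : fiber f k => x i := by
  filter_upwards [ae_norm_lt_one_haarPowP K (Fin N)] with x hx
  refine gasIntegrand_eq_prod_fibers _ _ s f _ x (fun i j hij => ?_) fun i j hij => ?_
  · rw [hij]
    exact sphericalDist_discChart hr _ (hx i) (hx j)
  · exact sphericalDist_discChart_of_ne hr hr' hij (hx i) (hx j)

theorem integrable_map_discCharts_iff (hr : ∀ k, ‖r k‖ ≤ 1)
    (hr' : ∀ x : K, ‖x‖ ≤ 1 → ∃! k, ‖x - r k‖ < 1) (f : Fin N → Fin (residueCard K + 1)) :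
    Integrable (projIntegrand K s)
        ((haarPowP K (Fin N)).map fun x i => discChart r (f i) (x i)) ↔
      ∏ k, absIntegralP K (fun i j : fiber f k => s i j) ≠ ⊤ := by
  rw [integrable_map_measure (measurable_projIntegrand s).aestronglyMeasurable
    (measurable_discCharts r f).aemeasurable, ← integrable_prod_fibers_iff]
  exact integrable_congr (projIntegrand_discCharts_ae s hr hr' f)

theorem integrable_projIntegrand_iff_forall (hr : ∀ k, ‖r k‖ ≤ 1)
    (hr' : ∀ x : K, ‖x‖ ≤ 1 → ∃! k, ‖x - r k‖ < 1) :
    Integrable (projIntegrand K s) (projMeasurePow K N) ↔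
      ∀ f : Fin N → Fin (residueCard K + 1),
        ∏ k, absIntegralP K (fun i j : fiber f k => s i j) ≠ ⊤ := by
  rw [projMeasurePow_eq hr hr', integrable_smul_measure
    (pow_ne_zero _ (discMass_ne_zero K)) (ENNReal.pow_ne_top (discMass_ne_top K)),
    integrable_finsetSum_measure]
  simp [integrable_map_discCharts_iff s hr hr']

theorem branchExponent_re (J : Finset (Fin N)) :
    (branchExponent J s).re = (J.card : ℝ) - 1 + (pairSum J s).re := by
  simp [branchExponent, pairSum]

theorem integrable_projIntegrand_iff (hK : IsCanonicalNorm K) :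
    Integrable (projIntegrand K s) (projMeasurePow K N) ↔ s ∈ convergenceDomain N := by
  obtain ⟨r, hr, hr'⟩ := exists_representatives K
  rw [integrable_projIntegrand_iff_forall s hr hr']
  constructor
  · intro h J hJ
    let f : Fin N → Fin (residueCard K + 1) := fun i => if i ∈ J then 0 else Fin.last _
    have hlast : Fin.last (residueCard K) ≠ 0 := by
      rw [Ne, Fin.last_eq_zero_iff]
      exact (zero_lt_one.trans (one_lt_residueCard K)).ne'
    have hfib : fiber f 0 = J := by
      ext i
      simp only [mem_fiber, f]
      split_ifs with hi <;> simp [hi, hlast]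
    have h0 : absIntegralP K (fun i j : fiber f 0 => s i j) ≠ ⊤ := by
      intro htop
      refine h f ?_
      rw [← Finset.mul_prod_erase _ _ (Finset.mem_univ 0), htop, ENNReal.top_mul]
      exact Finset.prod_ne_zero_iff.2 fun k _ => absIntegralP_ne_zero hK _
    rw [hfib] at h0
    have := exponent_pos_of_absIntegralP_ne_top hK (by rwa [Fintype.card_coe]) h0
    rwa [branchExponent_re, ← pairSum_univ_coe, ← Fintype.card_coe]
  · intro h f
    refine ENNReal.prod_ne_top fun k _ => absIntegralP_ne_top hK _ fun J hJ => ?_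
    rw [pairSum_coe, ← Finset.card_map (Function.Embedding.subtype _), ← branchExponent_re]
    exact h _ (by rwa [Finset.card_map])

theorem integral_map_discCharts (hr : ∀ k, ‖r k‖ ≤ 1)
    (hr' : ∀ x : K, ‖x‖ ≤ 1 → ∃! k, ‖x - r k‖ < 1) (f : Fin N → Fin (residueCard K + 1)) :
    ∫ x, projIntegrand K s x ∂(haarPowP K (Fin N)).map (fun x i => discChart r (f i) (x i)) =
      ∏ k, partitionFunction (fiber f k) {x : K | ‖x‖ < 1} s := by
  rw [integral_map (measurable_discCharts r f).aemeasurable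
    (measurable_projIntegrand s).aestronglyMeasurable,
    integral_congr_ae (projIntegrand_discCharts_ae s hr hr' f)]
  simp_rw [partitionFunction_eq_integral]
  exact integral_prod_fibers f (haarP K) fun k => fieldIntegrand fun i j : fiber f k => s i j

/-- Ordered partitions of `[N]` into `m` parts are the same as functions to an `m`-element set. -/
theorem sum_orderedPartitions (m : ℕ) (g : (Fin m → Finset (Fin N)) → ℂ) :
    ∑ I ∈ orderedPartitions N m, g I = ∑ f : Fin N → Fin m, g (fiber f) := by
  classical
  symm
  refine Finset.sum_bij (fun f _ => fiber f) ?_ ?_ ?_ fun _ _ => rfl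
  · intro f _
    simp only [orderedPartitions, Finset.mem_filter, Finset.mem_univ, true_and]
    refine ⟨fun k l hkl => Finset.disjoint_left.2 fun i hi hi' => ?_, ?_⟩
    · exact hkl ((mem_fiber.1 hi).symm.trans (mem_fiber.1 hi'))
    · ext i
      simp
  · intro f _ f' _ h
    ext i
    have : i ∈ fiber f' (f i) := by
      rw [← congrFun h (f i)]
      simp
    rw [mem_fiber.1 this]
  · intro I hI
    simp only [orderedPartitions, Finset.mem_filter, Finset.mem_univ, true_and] at hI
    have hex : ∀ i, ∃ k, i ∈ I k := fun i => by
      have := Finset.mem_univ i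
      rw [← hI.2] at this
      simpa using this
    choose f hf using hex
    refine ⟨f, Finset.mem_univ _, ?_⟩
    ext k i
    rw [mem_fiber]
    constructor
    · rintro rfl
      exact hf i
    · intro hi
      by_contra hne
      exact Finset.disjoint_left.1 (hI.1 _ _ hne) (hf i) hi

theorem projPartitionFunction_eq (hK : IsCanonicalNorm K) (hs : s ∈ convergenceDomain N) :
    projPartitionFunction K s = ((residueCard K : ℂ) / ((residueCard K : ℂ) + 1)) ^ N *
      ∑ I ∈ orderedPartitions N (residueCard K + 1),
        ∏ k, partitionFunction (I k) {x : K | ‖x‖ < 1} s := by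
  obtain ⟨r, hr, hr'⟩ := exists_representatives K
  have hint := (integrable_projIntegrand_iff_forall s hr hr').1
    ((integrable_projIntegrand_iff s hK).2 hs)
  rw [projPartitionFunction, projMeasurePow_eq hr hr', integral_smul_measure,
    integral_finsetSum_measure fun f _ => (integrable_map_discCharts_iff s hr hr' f).2 (hint f),
    sum_orderedPartitions, ENNReal.toReal_pow, toReal_discMass, Complex.real_smul]
  congr 1
  · push_cast
    rfl
  · exact Finset.sum_congr rfl fun f _ => integral_map_discCharts s hr hr' f

end Main

end LogCoulomb

end

theorem theorem3p4 (K : Type*) [NontriviallyNormedField K] [IsUltrametricDist K]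
    [LocallyCompactSpace K] [MeasurableSpace K] [BorelSpace K] (hK : IsCanonicalNorm K)
    (N : ℕ) (hN : 2 ≤ N) (s : Fin N → Fin N → ℂ) :
    (Integrable (projIntegrand K s) (projMeasurePow K N) ↔
        s ∈ convergenceDomain N) ∧
      (s ∈ convergenceDomain N →
        projPartitionFunction K s =
          ((residueCard K : ℂ) / ((residueCard K : ℂ) + 1)) ^ N *
            ∑ I ∈ orderedPartitions N (residueCard K + 1),
              ∏ k, partitionFunction (I k) {x : K | ‖x‖ < 1} s) := by
  exact ⟨integrable_projIntegrand_iff s hK, projPartitionFunction_eq s hK⟩
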